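/- **Channel Capacity Bounds.** Let $N,D\ge 1$ be integers, $P,\sigma>0$, and $\mathrm{SNR}=P/\sigma^2$. Consider the channel $y=X\beta+\varepsilon$ with input $\beta\in\mathbb{R}^D$ and output $(y,X)$, where $X\in\mathbb{R}^{N\times D}$ has i.i.d. entries $X_{ij}\sim\mathcal{N}(0,1)$, $\varepsilon\sim\mathcal{N}(0,\sigma^2 I_N)$, and $\beta$, $X$, $\varepsilon$ are independent. Let its capacity be $$\mathcal{C}=\sup\left\{\mathcal{I}\big(\beta;(y,X)\big) : \beta \text{ a random vector in } \mathbb{R}^D \text{ with } \mathbb{E}[\beta^{\intercal}\beta]\le P\right\},$$ where $\mathcal{I}$ denotes mutual information in nats (all logarithms are natural). Let $\Psi=\Gamma'/\Gamma$ be the digamma function. Then $\mathcal{C}$ is finite and equal to $$\mathcal{C}=\frac12\,\mathbb{E}\left[\log\det\left(I_N+\frac{\mathrm{SNR}}{D}XX^{\intercal}\right)\right],$$ the expectation being that of an integrable random variable, and it is bounded as follows. If $D\le N$, then $$\frac D2\log\left(\frac{2\,\mathrm{SNR}}{D}\right)+\frac12\sum_{i=1}^{D}\Psi\left(\frac{N-i+1}{2}\right)\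 \le\ \mathcal{C}\ \le\ \frac D2\log\left(\frac ND\,\mathrm{SNR}+1\right).$$ If $D>N$, then $$\frac N2\log\left(\frac{2\,\mathrm{SNR}}{D}\right)+\frac12\sum_{i=1}^{N}\Psi\left(\frac{D-i+1}{2}\right)\ \le\ \mathcal{C}\ \le\ \frac N2\log\left(\mathrm{SNR}+1\right).$$ -/

import Mathlib

open MeasureTheory ProbabilityTheory InformationTheory
open scoped ENNReal Matrix

noncomputable section

/-- The real digamma function `Ψ = Γ' / Γ`. -/
def realDigamma (x : ℝ) : ℝ := logDeriv Real.Gamma x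

/-- The mutual information (in nats) of a pair of random variables with joint law `γ`:
the Kullback-Leibler divergence of `γ` from the product of its marginals. -/
def mutualInfo {A B : Type*} [MeasurableSpace A] [MeasurableSpace B] (γ : Measure (A × B)) :
    ℝ≥0∞ :=
  klDiv γ (γ.fst.prod γ.snd)

/-- The law of a random `N × D` matrix with independent standard Gaussian entries. -/
def gaussianMatrixLaw (N D : ℕ) : Measure (Fin N → Fin D → ℝ) :=
  Measure.pi fun _ => Measure.pi fun _ => gaussianReal 0 1

/-- The law of the noise vector `ε ∼ N(0, σ² I_N)`. -/
def noiseLaw (N : ℕ) (σ : ℝ) : Measure (Fin N → ℝ) :=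
  Measure.pi fun _ => gaussianReal 0 (σ ^ 2).toNNReal

/-- The joint law of the input `β` and the output `(y, X)` of the channel `y = X β + ε`,
where `β ∼ ν`, `X` and `ε` are independent. -/
def channelJointLaw (N D : ℕ) (σ : ℝ) (ν : Measure (Fin D → ℝ)) :
    Measure ((Fin D → ℝ) × ((Fin N → ℝ) × (Fin N → Fin D → ℝ))) :=
  (ν.prod ((gaussianMatrixLaw N D).prod (noiseLaw N σ))).map
    fun ω => (ω.1, (Matrix.of ω.2.1 *ᵥ ω.1 + ω.2.2, ω.2.1))

/-- The input laws that satisfy the power constraint `E[βᵀ β] ≤ P`. -/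
def admissibleInputs (D : ℕ) (P : ℝ) : Set (Measure (Fin D → ℝ)) :=
  {ν | IsProbabilityMeasure ν ∧
    ∫⁻ b, ENNReal.ofReal (∑ i, b i ^ 2) ∂ν ≤ ENNReal.ofReal P}

/-- The channel capacity: the supremum of the mutual information `I(β; (y, X))` over all input
laws that satisfy the power constraint. -/
def channelCapacity (N D : ℕ) (P σ : ℝ) : ℝ≥0∞ :=
  ⨆ ν ∈ admissibleInputs D P, mutualInfo (channelJointLaw N D σ ν)

/-- The signal-to-noise ratio `P / σ²`. -/
def signalToNoise (P σ : ℝ) : ℝ := P / σ ^ 2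

/-- The function `X ↦ log det (I_N + (s / D) X Xᵀ)`. -/
def logDetGram (N D : ℕ) (s : ℝ) (X : Fin N → Fin D → ℝ) : ℝ :=
  Real.log (1 + (s / D) • (Matrix.of X * (Matrix.of X)ᵀ)).det

end

/-! For any output law `q`, the mutual information is at most the divergence of the joint law from
(input law) ⊗ `q`, with equality when `q` is the true output marginal (`mutualInfo_le_klDiv_prod`).
Take for `q` the output law produced by the input N(0, (P/D) I). Given X that output is N(0, σ²(I +
cXXᵀ)) with c = SNR/D, so the likelihood ratio is explicit and the divergence can be computed for
every input with finite second moment.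

The computation works because the law of X is invariant under sign changes and permutations of its
columns: E[Xᵀ(I + cXXᵀ)⁻¹X] is a multiple of the identity, so the input enters only through E|β|².
By `klDiv_channelJointLaw` the divergence is ½ E log det(I + cXXᵀ) plus a nonnegative multiple of
E|β|² − P. The power constraint bounds it, and the isotropic Gaussian input attains the bound.

The upper estimates are Jensen's inequality for log det, in tangent-line form
(`log_det_regGram_upper`). For the lower ones, X is built row by row (`log_det_regGram_lower`). A
new row x multiplies the determinant by 1 + c xᵀ(I + cXᵀX)⁻¹x, which is at least 1 + c|Ux|² with U
an orthonormal family in the kernel of the earlier rows. Here |Ux|² is chi-squared, and the digamma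
values come from its expected logarithm. When D ≤ N both estimates are applied to Xᵀ. -/

/-! ### Determinants, traces and quadratic forms of I + cMMᵀ. -/

section LinearAlgebra

variable {m n : Type*} [Fintype m] [Fintype n] [DecidableEq m]

/-- The tangent line of log at `t` lies above log; apply this to each eigenvalue and sum. Taking `t
= 1` gives integrability, and a well-chosen `t` gives the sharp upper bound. -/
lemma Matrix.PosDef.log_det_le [DecidableEq n] {A : Matrix n n ℝ} (hA : A.PosDef) {t : ℝ} (ht : 0 < t) :
    Real.log A.det ≤ Fintype.card n * Real.log t + A.trace / t - Fintype.card n := by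
  have hpos := fun i => hA.eigenvalues_pos i
  have h1 : Real.log A.det = ∑ i, Real.log (hA.1.eigenvalues i) := by
    rw [hA.1.det_eq_prod_eigenvalues]
    simp only [RCLike.ofReal_real_eq_id, id]
    exact Real.log_prod fun i _ => (hpos i).ne'
  have h2 : A.trace = ∑ i, hA.1.eigenvalues i := by
    simpa using hA.1.trace_eq_sum_eigenvalues
  have h3 : ∀ i, Real.log (hA.1.eigenvalues i) ≤
      Real.log t + hA.1.eigenvalues i / t - 1 := fun i => by
    have := Real.log_le_sub_one_of_pos (div_pos (hpos i) ht)
    rw [Real.log_div (hpos i).ne' ht.ne'] at this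
    linarith
  calc Real.log A.det = _ := h1
    _ ≤ ∑ i, (Real.log t + hA.1.eigenvalues i / t - 1) := Finset.sum_le_sum fun i _ => h3 i
    _ = _ := by simp [Finset.sum_sub_distrib, Finset.sum_add_distrib, h2, Finset.sum_div]

lemma posDef_one_add_smul_mul_transpose {c : ℝ} (hc : 0 ≤ c) (M : Matrix m n ℝ) :
    (1 + c • (M * Mᵀ)).PosDef := by
  refine Matrix.PosDef.one.add_posSemidef (Matrix.PosSemidef.smul ?_ hc)
  simpa using Matrix.posSemidef_self_mul_conjTranspose M

lemma det_one_add_smul_mul_transpose_comm [DecidableEq n] (c : ℝ) (M : Matrix m n ℝ) :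
    (1 + c • (M * Mᵀ)).det = (1 + c • (Mᵀ * M)).det := by
  rw [← Matrix.smul_mul, Matrix.det_one_add_mul_comm, Matrix.mul_smul]

/-- Expand the trace of A⁻¹A = 1 and use cyclicity. This identity links the noise contribution to
the signal contribution in the divergence. -/
lemma trace_inv_add_smul_trace {c : ℝ} (hc : 0 ≤ c) (M : Matrix m n ℝ) :
    ((1 + c • (M * Mᵀ))⁻¹).trace + c * (Mᵀ * (1 + c • (M * Mᵀ))⁻¹ * M).trace = Fintype.card m := by
  set A := 1 + c • (M * Mᵀ) with hA
  have h : A⁻¹ * A = 1 :=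
    Matrix.nonsing_inv_mul _ (posDef_one_add_smul_mul_transpose hc M).det_pos.ne'.isUnit
  have h2 : (A⁻¹ * A).trace = Fintype.card m := by rw [h, Matrix.trace_one]
  rw [← h2]
  conv_rhs => rw [hA, mul_add, mul_one, Matrix.trace_add, Matrix.mul_smul, Matrix.trace_smul,
    ← hA, smul_eq_mul, ← Matrix.mul_assoc, Matrix.trace_mul_comm, ← Matrix.mul_assoc]

lemma dotProduct_inv_mulVec_nonneg {A : Matrix m m ℝ} (hA : A.PosDef) (v : m → ℝ) :
    0 ≤ v ⬝ᵥ (A⁻¹ *ᵥ v) := by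
  simpa using hA.inv.posSemidef.dotProduct_mulVec_nonneg v

lemma trace_transpose_mul_inv_mul_nonneg {A : Matrix m m ℝ} (hA : A.PosDef) (M : Matrix m n ℝ) :
    0 ≤ (Mᵀ * A⁻¹ * M).trace := by
  have := (hA.inv.posSemidef.conjTranspose_mul_mul_same M).trace_nonneg
  simpa using this

/-- The tangent bound at 1 for A⁻¹ reads −log det A ≤ tr A⁻¹ − m, and the trace identity makes the
right side nonpositive. -/
lemma log_det_one_add_nonneg {c : ℝ} (hc : 0 ≤ c) (M : Matrix m n ℝ) :
    0 ≤ Real.log (1 + c • (M * Mᵀ)).det := by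
  have hA := posDef_one_add_smul_mul_transpose hc M
  have h1 := hA.inv.log_det_le one_pos
  have h2 := trace_inv_add_smul_trace hc M
  have h3 := mul_nonneg hc (trace_transpose_mul_inv_mul_nonneg hA M)
  rw [Matrix.det_nonsing_inv, Ring.inverse_eq_inv', Real.log_inv] at h1
  simp only [Real.log_one, mul_zero, div_one, zero_add] at h1
  linarith

/-- With w = A⁻¹v and z = MMᵀw one has v = w + cz, so |v|² − v·w = c w·z + c²|z|² ≥ 0. This
dominates the quadratic forms whose integrability is needed later. -/
lemma dotProduct_inv_mulVec_le {c : ℝ} (hc : 0 ≤ c) (M : Matrix m n ℝ) (v : m → ℝ) :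
    v ⬝ᵥ ((1 + c • (M * Mᵀ))⁻¹ *ᵥ v) ≤ v ⬝ᵥ v := by
  have hA := posDef_one_add_smul_mul_transpose hc M
  set A := 1 + c • (M * Mᵀ) with hAdef
  set w := A⁻¹ *ᵥ v with hw
  have hv : v = w + c • (M *ᵥ (Mᵀ *ᵥ w)) := by
    have : A *ᵥ w = v := by
      rw [hw, Matrix.mulVec_mulVec, Matrix.mul_nonsing_inv _ hA.det_pos.ne'.isUnit,
        Matrix.one_mulVec]
    conv_lhs => rw [← this, hAdef, Matrix.add_mulVec, Matrix.one_mulVec, Matrix.smul_mulVec,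
      ← Matrix.mulVec_mulVec]
  set z := M *ᵥ (Mᵀ *ᵥ w) with hz
  have hwz : 0 ≤ w ⬝ᵥ z := by
    have : w ⬝ᵥ z = (Mᵀ *ᵥ w) ⬝ᵥ (Mᵀ *ᵥ w) := by
      rw [hz, Matrix.dotProduct_mulVec, ← Matrix.mulVec_transpose]
    rw [this]; exact Finset.sum_nonneg fun i _ => mul_self_nonneg _
  have hzz : 0 ≤ z ⬝ᵥ z := Finset.sum_nonneg fun i _ => mul_self_nonneg _
  have : v ⬝ᵥ v = v ⬝ᵥ w + c * (w ⬝ᵥ z) + c * (c * (z ⬝ᵥ z)) := by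
    conv_lhs => rw [hv]
    conv_rhs => rw [hv]
    simp only [add_dotProduct, dotProduct_add, smul_dotProduct, dotProduct_smul, smul_eq_mul,
      dotProduct_comm z w]
    ring
  rw [this]
  have := mul_nonneg hc hwz
  have := mul_nonneg hc (mul_nonneg hc hzz)
  linarith

lemma det_add_smul_vecMulVec {A : Matrix m m ℝ} (hA : A.PosDef) (c : ℝ) (x : m → ℝ) :
    (A + c • Matrix.vecMulVec x x).det = A.det * (1 + c * (x ⬝ᵥ (A⁻¹ *ᵥ x))) := by
  have h := Matrix.det_add_replicateCol_mul_replicateRow (ι := Unit) hA.det_pos.ne'.isUnit (c • x) x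
  have h' : Matrix.replicateCol Unit (c • x) * Matrix.replicateRow Unit x
      = c • Matrix.vecMulVec x x := by
    ext i j; simp [Matrix.mul_apply, Matrix.vecMulVec_apply, mul_assoc]
  rw [h'] at h
  rw [h]
  congr 1
  simp [Matrix.det_unique, Matrix.mul_assoc]
  simp [Matrix.mul_apply, dotProduct, Matrix.mulVec, Finset.mul_sum]

/-- Let p be the projection of x onto the span of the `u i`. Since A⁻¹p = p, expanding (x − p)ᵀA⁻¹(x
− p) ≥ 0 leaves xᵀA⁻¹x ≥ |p|². -/
lemma sum_sq_le_dotProduct_inv_mulVec {ι : Type*} [Fintype ι] [DecidableEq ι] {A : Matrix m m ℝ}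
    (hA : A.PosDef) (u : ι → m → ℝ) (hu : ∀ i j, u i ⬝ᵥ u j = if i = j then 1 else 0)
    (hAu : ∀ i, A *ᵥ u i = u i) (x : m → ℝ) :
    ∑ i, (u i ⬝ᵥ x) ^ 2 ≤ x ⬝ᵥ (A⁻¹ *ᵥ x) := by
  set p := ∑ i, (u i ⬝ᵥ x) • u i with hp
  have hAp : A⁻¹ *ᵥ p = p := by
    have : A *ᵥ p = p := by
      simp only [hp, Matrix.mulVec_sum, Matrix.mulVec_smul, hAu]
    conv_lhs => rw [← this]
    rw [Matrix.mulVec_mulVec, Matrix.nonsing_inv_mul _ hA.det_pos.ne'.isUnit, Matrix.one_mulVec]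
  have hpx : p ⬝ᵥ x = ∑ i, (u i ⬝ᵥ x) ^ 2 := by
    simp [hp, sum_dotProduct, pow_two]
  have hpp : p ⬝ᵥ p = ∑ i, (u i ⬝ᵥ x) ^ 2 := by
    simp [hp, sum_dotProduct, dotProduct_sum, hu, pow_two]
  have hsymm : p ⬝ᵥ (A⁻¹ *ᵥ x) = p ⬝ᵥ x := by
    have hT : (A⁻¹)ᵀ = A⁻¹ := by simpa [Matrix.IsHermitian] using hA.inv.1.eq
    rw [Matrix.dotProduct_mulVec, ← Matrix.mulVec_transpose, hT, hAp]
  have h0 := dotProduct_inv_mulVec_nonneg hA (x - p)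
  simp only [Matrix.mulVec_sub, hAp, sub_dotProduct, dotProduct_sub, hsymm, hpp, hpx,
    dotProduct_comm x p] at h0
  linarith

end LinearAlgebra

/-! ### Variational bound for mutual information. -/

section Golden

variable {A B : Type*} [MeasurableSpace A] [MeasurableSpace B]

lemma klDiv_map_measurableEquiv (e : A ≃ᵐ B) (μ ν : Measure A) [IsFiniteMeasure μ]
    [IsFiniteMeasure ν] : klDiv (μ.map e) (ν.map e) = klDiv μ ν := by
  refine le_antisymm (klDiv_map_le _ _ e.measurable) ?_
  have := klDiv_map_le (μ.map e) (ν.map e) e.symm.measurable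
  rwa [Measure.map_map e.symm.measurable e.measurable,
    Measure.map_map e.symm.measurable e.measurable, e.symm_comp_self, Measure.map_id,
    Measure.map_id] at this

/-- Replacing the output marginal by any other law can only increase the divergence. -/
lemma mutualInfo_le_klDiv_prod [StandardBorelSpace A] [Nonempty A] (γ : Measure (A × B))
    [IsProbabilityMeasure γ] (q : Measure B) [IsProbabilityMeasure q] :
    mutualInfo γ ≤ klDiv γ (γ.fst.prod q) := by
  -- Swapping the factors puts the output first, so that the chain rule isolates the output
  -- marginals.
  have key : ∀ q : Measure B, IsProbabilityMeasure q →
      klDiv γ (γ.fst.prod q) = klDiv (γ.map Prod.swap) (q.prod γ.fst) := fun q _ => by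
    rw [← show (γ.fst.prod q).map Prod.swap = q.prod γ.fst from Measure.prod_swap]
    exact (klDiv_map_measurableEquiv (MeasurableEquiv.prodComm (α := A) (β := B)) γ (γ.fst.prod q)).symm
  have : IsProbabilityMeasure (γ.map Prod.swap) :=
    Measure.isProbabilityMeasure_map measurable_swap.aemeasurable
  rw [mutualInfo, key _ inferInstance, key _ inferInstance]
  have hfst : (γ.map Prod.swap).fst = γ.snd := by
    rw [Measure.fst, Measure.map_map measurable_fst measurable_swap]; rfl
  have hdis := (γ.map Prod.swap).disintegrate (γ.map Prod.swap).condKernel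
  rw [hfst] at hdis
  -- By the chain rule the two divergences differ by the divergence of `γ.snd` from `q`, which is
  -- nonnegative.
  rw [← hdis, ← Measure.compProd_const, ← Measure.compProd_const, klDiv_compProd_eq_add γ.snd q]
  exact le_add_self

end Golden

/-! ### Densities and characteristic functions of Gaussian vectors. -/

section GaussianDensity

open scoped MatrixOrder Matrix.Norms.L2Operator in
lemma Matrix.PosSemidef.exists_eq_transpose_mul_self {n : Type*} [Fintype n] [DecidableEq n]
    {S : Matrix n n ℝ} (hS : S.PosSemidef) : ∃ C : Matrix n n ℝ, S = Cᵀ * C := by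
  obtain ⟨C, hC⟩ := CStarAlgebra.nonneg_iff_eq_star_mul_self.mp hS.nonneg
  exact ⟨C, by simpa [Matrix.star_eq_conjTranspose] using hC⟩

variable {ι : Type*} [Fintype ι]

/-- The density of the centred Gaussian law with covariance matrix `S`. -/
noncomputable def centredGaussianDensity [DecidableEq ι] (S : Matrix ι ι ℝ) (y : ι → ℝ) : ℝ :=
  (√(2 * Real.pi))⁻¹ ^ Fintype.card ι * (√S.det)⁻¹ * Real.exp (-(y ⬝ᵥ (S⁻¹ *ᵥ y)) / 2)

lemma pi_gaussianReal_eq_withDensity :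
    Measure.pi (fun _ : ι => gaussianReal 0 1) = volume.withDensity fun x =>
      ENNReal.ofReal ((√(2 * Real.pi))⁻¹ ^ Fintype.card ι * Real.exp (-(x ⬝ᵥ x) / 2)) := by
  have hprod : ∀ x : ι → ℝ, (√(2 * Real.pi))⁻¹ ^ Fintype.card ι * Real.exp (-(x ⬝ᵥ x) / 2) =
      ∏ i, gaussianPDFReal 0 1 (x i) := fun x => by
    simp only [gaussianPDFReal, Finset.prod_mul_distrib, Finset.prod_const, ← Real.exp_sum,
      Finset.card_univ, NNReal.coe_one, mul_one, sub_zero]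
    rw [← Finset.sum_div, Finset.sum_neg_distrib]
    simp [dotProduct, pow_two]
  simp_rw [hprod]
  refine Measure.pi_eq fun s hs => ?_
  rw [withDensity_apply _ (MeasurableSet.univ_pi hs), volume_pi, Measure.restrict_pi_pi,
    ← ofReal_integral_eq_lintegral_ofReal, integral_fintype_prod_eq_prod,
    ENNReal.ofReal_prod_of_nonneg]
  · refine Finset.prod_congr rfl fun i _ => ?_
    rw [gaussianReal_apply_eq_integral _ one_ne_zero]
  · exact fun i _ => integral_nonneg fun x => gaussianPDFReal_nonneg _ _ _
  · exact Integrable.fintype_prod fun i => (integrable_gaussianPDFReal 0 1).restrict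
  · exact Filter.Eventually.of_forall fun x =>
      Finset.prod_nonneg fun i _ => gaussianPDFReal_nonneg _ _ _

lemma charFun_map_toLp (ρ : Measure (ι → ℝ)) (t : EuclideanSpace ℝ ι) :
    charFun (ρ.map (WithLp.toLp 2)) t = ∫ x, Complex.exp ((x ⬝ᵥ t.ofLp : ℝ) * Complex.I) ∂ρ := by
  rw [charFun_apply, ← MeasurableEquiv.coe_toLp, integral_map_equiv]
  simp [PiLp.inner_apply, dotProduct, mul_comm]

lemma integral_exp_dotProduct_pi_gaussianReal (v : NNReal) (t : ι → ℝ) :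
    ∫ x, Complex.exp ((x ⬝ᵥ t : ℝ) * Complex.I) ∂(Measure.pi fun _ : ι => gaussianReal 0 v) =
      Complex.exp (-((v * (t ⬝ᵥ t) / 2 : ℝ) : ℂ)) := by
  have h := charFun_map_toLp (Measure.pi fun _ : ι => gaussianReal 0 v) (WithLp.toLp 2 t)
  rw [charFun_pi] at h
  simp only at h
  rw [← h]
  simp only [charFun_gaussianReal, ← Complex.exp_sum]
  congr 1
  simp [dotProduct, Finset.mul_sum, Finset.sum_div, pow_two]

variable [DecidableEq ι]

/-- Linear change of variables: the Jacobian |det B|⁻¹ is det(BBᵀ)^(-1/2), and |B⁻¹y|² = yᵀ(BBᵀ)⁻¹y.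
-/
lemma map_mulVec_pi_gaussianReal (B : Matrix ι ι ℝ) (hB : B.det ≠ 0) :
    (Measure.pi (fun _ : ι => gaussianReal 0 1)).map (fun x => B *ᵥ x) =
      volume.withDensity fun y => ENNReal.ofReal (centredGaussianDensity (B * Bᵀ) y) := by
  have hBm : Measurable fun x : ι → ℝ => B *ᵥ x :=
    (Continuous.matrix_mulVec continuous_const continuous_id).measurable
  have hBm' : Measurable fun x : ι → ℝ => B⁻¹ *ᵥ x :=
    (Continuous.matrix_mulVec continuous_const continuous_id).measurable
  have hdm : Measurable fun x : ι → ℝ =>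
      ENNReal.ofReal ((√(2 * Real.pi))⁻¹ ^ Fintype.card ι * Real.exp (-(x ⬝ᵥ x) / 2)) := by
    unfold dotProduct; fun_prop
  have hdm' : Measurable fun y : ι → ℝ =>
      ENNReal.ofReal (centredGaussianDensity (B * Bᵀ) y) := by
    unfold centredGaussianDensity dotProduct Matrix.mulVec dotProduct; fun_prop
  refine Measure.ext_of_lintegral _ fun F hF => ?_
  rw [lintegral_map hF hBm, pi_gaussianReal_eq_withDensity,
    lintegral_withDensity_eq_lintegral_mul _ hdm (show Measurable fun x => F (B *ᵥ x) from hF.comp hBm),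
    lintegral_withDensity_eq_lintegral_mul _ hdm' hF]
  have hcancel : ∀ x, B⁻¹ *ᵥ (B *ᵥ x) = x := fun x => by
    rw [Matrix.mulVec_mulVec, Matrix.nonsing_inv_mul _ hB.isUnit, Matrix.one_mulVec]
  set G : (ι → ℝ) → ℝ≥0∞ := fun y => ENNReal.ofReal ((√(2 * Real.pi))⁻¹ ^ Fintype.card ι *
    Real.exp (-((B⁻¹ *ᵥ y) ⬝ᵥ (B⁻¹ *ᵥ y)) / 2)) * F y with hG
  have hGm : Measurable G := (hdm.comp hBm').mul hF
  have h1 : ∫⁻ x, G (B *ᵥ x) = ENNReal.ofReal |(B.det)⁻¹| * ∫⁻ y, G y := by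
    rw [← lintegral_map hGm hBm]
    have := Real.map_matrix_volume_pi_eq_smul_volume_pi hB
    rw [show (fun x => B *ᵥ x) = Matrix.toLin' B from rfl, this, lintegral_smul_measure, smul_eq_mul]
  have hL : ∫⁻ x, G (B *ᵥ x) = ∫⁻ x, (((fun x => ENNReal.ofReal ((√(2 * Real.pi))⁻¹ ^ Fintype.card ι *
      Real.exp (-(x ⬝ᵥ x) / 2))) * (fun x => F (B *ᵥ x)) : (ι → ℝ) → ℝ≥0∞)) x := by
    simp only [hG, hcancel, Pi.mul_apply]
  refine hL.symm.trans (h1.trans ?_)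
  rw [← lintegral_const_mul _ hGm]
  refine lintegral_congr fun y => ?_
  simp only [hG, Pi.mul_apply, ← mul_assoc]
  rw [← ENNReal.ofReal_mul (abs_nonneg _)]
  congr 2
  have hq : (B⁻¹ *ᵥ y) ⬝ᵥ (B⁻¹ *ᵥ y) = y ⬝ᵥ ((B * Bᵀ)⁻¹ *ᵥ y) := by
    rw [Matrix.mul_inv_rev, ← Matrix.mulVec_mulVec, Matrix.dotProduct_mulVec y,
      ← Matrix.mulVec_transpose, ← Matrix.transpose_nonsing_inv, Matrix.transpose_transpose]
  rw [centredGaussianDensity, hq, Matrix.det_mul, Matrix.det_transpose, Real.sqrt_mul_self_eq_abs,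
    abs_inv]
  ring

/-- Write S = CᵀC. The image of a standard Gaussian under Cᵀ has the stated density and the same
characteristic function as `ρ`, so uniqueness applies. Later Gaussian laws are identified through
this criterion. -/
lemma eq_withDensity_of_charFun (ρ : Measure (ι → ℝ)) [IsFiniteMeasure ρ] {S : Matrix ι ι ℝ}
    (hS : S.PosDef) (h : ∀ t : ι → ℝ, ∫ x, Complex.exp ((x ⬝ᵥ t : ℝ) * Complex.I) ∂ρ =
      Complex.exp (-((t ⬝ᵥ (S *ᵥ t) / 2 : ℝ) : ℂ))) :
    ρ = volume.withDensity fun y => ENNReal.ofReal (centredGaussianDensity S y) := by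
  obtain ⟨C, hC⟩ := hS.posSemidef.exists_eq_transpose_mul_self
  have hC' : S = Cᵀ * Cᵀᵀ := by simpa using hC
  have hdet : (Cᵀ).det ≠ 0 := fun h0 => by
    have := hS.det_pos
    rw [hC', Matrix.det_mul, h0, zero_mul] at this
    exact lt_irrefl _ this
  have hm : Measurable fun x : ι → ℝ => Cᵀ *ᵥ x :=
    (Continuous.matrix_mulVec continuous_const continuous_id).measurable
  rw [hC', ← map_mulVec_pi_gaussianReal _ hdet]
  have : IsFiniteMeasure ((Measure.pi (fun _ : ι => gaussianReal 0 1)).map (fun x => Cᵀ *ᵥ x)) :=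
    Measure.isFiniteMeasure_map _ _
  refine (MeasurableEquiv.toLp 2 (ι → ℝ)).map_measurableEquiv_injective
    (Measure.ext_of_charFun (funext fun t => ?_))
  rw [MeasurableEquiv.coe_toLp, charFun_map_toLp, charFun_map_toLp, h,
    integral_map hm.aemeasurable
      (Continuous.aestronglyMeasurable (by unfold dotProduct; fun_prop))]
  have hadj : ∀ x : ι → ℝ, (Cᵀ *ᵥ x) ⬝ᵥ t.ofLp = x ⬝ᵥ (C *ᵥ t.ofLp) := fun x => by
    rw [Matrix.mulVec_transpose, Matrix.dotProduct_mulVec]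
  simp_rw [hadj]
  rw [integral_exp_dotProduct_pi_gaussianReal, hC', Matrix.transpose_transpose,
    ← Matrix.mulVec_mulVec, dotProduct_comm _ (Cᵀ *ᵥ _), hadj]
  simp

end GaussianDensity

/-! ### Output law of a Gaussian input for a fixed matrix. -/

section Channel

variable {m n : Type*} [Fintype m] [Fintype n] [DecidableEq m]

/-- The law of `M β + ε` for independent `β ∼ N(0, p I)` and `ε ∼ N(0, v I)`. -/
lemma map_mulVec_add_eq_withDensity (M : Matrix m n ℝ) (p v : NNReal) (hv : 0 < v) :
    ((Measure.pi fun _ : n => gaussianReal 0 p).prod (Measure.pi fun _ : m => gaussianReal 0 v)).map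
      (fun z => M *ᵥ z.1 + z.2) = volume.withDensity fun y =>
        ENNReal.ofReal (centredGaussianDensity ((v : ℝ) • (1 + (p / v : ℝ) • (M * Mᵀ))) y) := by
  have hv' : (0 : ℝ) < v := hv
  have hm : Measurable fun z : (n → ℝ) × (m → ℝ) => M *ᵥ z.1 + z.2 :=
    ((Continuous.matrix_mulVec continuous_const continuous_fst).add continuous_snd).measurable
  have : IsFiniteMeasure (((Measure.pi fun _ : n => gaussianReal 0 p).prod
    (Measure.pi fun _ : m => gaussianReal 0 v)).map (fun z => M *ᵥ z.1 + z.2)) :=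
    Measure.isFiniteMeasure_map _ _
  refine eq_withDensity_of_charFun _
    ((posDef_one_add_smul_mul_transpose (by positivity) M).smul hv') fun t => ?_
  rw [integral_map hm.aemeasurable
    (Continuous.aestronglyMeasurable (by unfold dotProduct; fun_prop))]
  -- The exponential factors into a function of the input and one of the noise, so independence
  -- multiplies the characteristic functions.
  have hsplit : ∀ z : (n → ℝ) × (m → ℝ),
      Complex.exp (((M *ᵥ z.1 + z.2) ⬝ᵥ t : ℝ) * Complex.I) =
      Complex.exp ((z.1 ⬝ᵥ (Mᵀ *ᵥ t) : ℝ) * Complex.I) *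
        Complex.exp ((z.2 ⬝ᵥ t : ℝ) * Complex.I) := fun z => by
    rw [← Complex.exp_add, ← add_mul, ← Complex.ofReal_add, add_dotProduct,
      dotProduct_comm (M *ᵥ z.1), Matrix.dotProduct_mulVec, ← Matrix.mulVec_transpose,
      dotProduct_comm _ z.1]
  simp_rw [hsplit]
  rw [integral_prod_mul (fun x => Complex.exp ((x ⬝ᵥ (Mᵀ *ᵥ t) : ℝ) * Complex.I))
    (fun x => Complex.exp ((x ⬝ᵥ t : ℝ) * Complex.I)), integral_exp_dotProduct_pi_gaussianReal,
    integral_exp_dotProduct_pi_gaussianReal, ← Complex.exp_add]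
  congr 1
  rw [← neg_add, ← Complex.ofReal_add]
  congr 2
  have : (Mᵀ *ᵥ t) ⬝ᵥ (Mᵀ *ᵥ t) = t ⬝ᵥ ((M * Mᵀ) *ᵥ t) := by
    rw [← Matrix.mulVec_mulVec, Matrix.dotProduct_mulVec t, ← Matrix.mulVec_transpose]
  rw [this, Matrix.smul_mulVec, Matrix.add_mulVec, Matrix.one_mulVec, Matrix.smul_mulVec,
    dotProduct_smul, dotProduct_add, dotProduct_smul]
  simp only [smul_eq_mul]
  field_simp
  ring

lemma pi_gaussianReal_eq_withDensity_of_pos (v : NNReal) (hv : 0 < v) :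
    (Measure.pi fun _ : m => gaussianReal 0 v) = volume.withDensity fun y =>
        ENNReal.ofReal (centredGaussianDensity ((v : ℝ) • (1 : Matrix m m ℝ)) y) := by
  refine eq_withDensity_of_charFun _ (Matrix.PosDef.one.smul (show (0 : ℝ) < v from hv))
    fun t => ?_
  rw [integral_exp_dotProduct_pi_gaussianReal]
  simp [Matrix.smul_mulVec]

end Channel

/-! ### Divergence from an explicit density. -/

section KL

variable {α : Type*} [MeasurableSpace α]

lemma klDiv_eq_of_withDensity {μ ρ : Measure α} [IsProbabilityMeasure μ] [IsProbabilityMeasure ρ]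
    {h : α → ℝ} (hm : Measurable h) (hpos : ∀ x, 0 < h x)
    (hμ : μ = ρ.withDensity fun x => ENNReal.ofReal (h x))
    (hint : Integrable (fun x => Real.log (h x)) μ) :
    klDiv μ ρ = ENNReal.ofReal (∫ x, Real.log (h x) ∂μ) := by
  have hac : μ ≪ ρ := hμ ▸ withDensity_absolutelyContinuous _ _
  have hllr : llr μ ρ =ᵐ[μ] fun x => Real.log (h x) := by
    have h1 : μ.rnDeriv ρ =ᵐ[ρ] fun x => ENNReal.ofReal (h x) := by
      rw [hμ]; exact Measure.rnDeriv_withDensity _ hm.ennreal_ofReal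
    filter_upwards [hac.ae_le h1] with x hx
    rw [llr, hx, ENNReal.toReal_ofReal (hpos x).le]
  rw [klDiv_of_ac_of_integrable hac (hint.congr hllr.symm), integral_congr_ae hllr]
  simp

end KL

/-! ### Densities of the channel laws and their likelihood ratio. -/

section Densities

variable {N D : ℕ}

instance isProbabilityMeasure_gaussianMatrixLaw : IsProbabilityMeasure (gaussianMatrixLaw N D) := by
  unfold gaussianMatrixLaw; infer_instance

instance isProbabilityMeasure_noiseLaw (σ : ℝ) : IsProbabilityMeasure (noiseLaw N σ) := by
  unfold noiseLaw; infer_instance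

/-- The matrix `I + c X Xᵀ`. -/
def regGram (c : ℝ) (X : Fin N → Fin D → ℝ) : Matrix (Fin N) (Fin N) ℝ :=
  1 + c • (Matrix.of X * (Matrix.of X)ᵀ)

lemma regGram_posDef {c : ℝ} (hc : 0 ≤ c) (X : Fin N → Fin D → ℝ) : (regGram c X).PosDef :=
  posDef_one_add_smul_mul_transpose hc _

lemma continuous_regGram (c : ℝ) : Continuous (regGram c : (Fin N → Fin D → ℝ) → _) := by
  unfold regGram
  exact continuous_const.add ((Continuous.matrix_mul continuous_id
    (Continuous.matrix_transpose continuous_id)).const_smul c)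

lemma continuous_regGram_inv {c : ℝ} (hc : 0 ≤ c) :
    Continuous fun X : Fin N → Fin D → ℝ => (regGram c X)⁻¹ := by
  simp only [Matrix.inv_def, Ring.inverse_eq_inv']
  exact ((continuous_regGram c).matrix_det.inv₀ fun X => (regGram_posDef hc X).det_pos.ne').smul
    (continuous_regGram c).matrix_adjugate

lemma continuous_log_det_regGram {c : ℝ} (hc : 0 ≤ c) :
    Continuous fun X : Fin N → Fin D → ℝ => Real.log (regGram c X).det :=
  (continuous_regGram c).matrix_det.log fun X => (regGram_posDef hc X).det_pos.ne'

/-- The likelihood ratio between the conditional output law given the input and the output law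
of a Gaussian input. -/
noncomputable def likelihoodRatio (v c : ℝ)
    (z : (Fin D → ℝ) × ((Fin N → ℝ) × (Fin N → Fin D → ℝ))) : ℝ :=
  √(regGram c z.2.2).det * Real.exp
    (-((z.2.1 - Matrix.of z.2.2 *ᵥ z.1) ⬝ᵥ (z.2.1 - Matrix.of z.2.2 *ᵥ z.1)) / (2 * v) +
      z.2.1 ⬝ᵥ ((regGram c z.2.2)⁻¹ *ᵥ z.2.1) / (2 * v))

lemma likelihoodRatio_pos {v c : ℝ} (hc : 0 ≤ c)
    (z : (Fin D → ℝ) × ((Fin N → ℝ) × (Fin N → Fin D → ℝ))) : 0 < likelihoodRatio v c z :=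
  mul_pos (Real.sqrt_pos.2 (regGram_posDef hc _).det_pos) (Real.exp_pos _)

lemma log_likelihoodRatio {v c : ℝ} (hc : 0 ≤ c)
    (z : (Fin D → ℝ) × ((Fin N → ℝ) × (Fin N → Fin D → ℝ))) :
    Real.log (likelihoodRatio v c z) = Real.log (regGram c z.2.2).det / 2 +
    (-((z.2.1 - Matrix.of z.2.2 *ᵥ z.1) ⬝ᵥ (z.2.1 - Matrix.of z.2.2 *ᵥ z.1)) / (2 * v) +
      z.2.1 ⬝ᵥ ((regGram c z.2.2)⁻¹ *ᵥ z.2.1) / (2 * v)) := by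
  have hdet := (regGram_posDef hc z.2.2).det_pos
  rw [likelihoodRatio, Real.log_mul (Real.sqrt_pos.2 hdet).ne' (Real.exp_pos _).ne', Real.log_exp,
    Real.log_sqrt hdet.le]

lemma continuous_mulVec_prod :
    Continuous fun z : (Fin D → ℝ) × (Fin N → Fin D → ℝ) => Matrix.of z.2 *ᵥ z.1 :=
  Continuous.matrix_mulVec continuous_snd continuous_fst

lemma continuous_likelihoodRatio (v : ℝ) {c : ℝ} (hc : 0 ≤ c) :
    Continuous (likelihoodRatio v c :
      (Fin D → ℝ) × ((Fin N → ℝ) × (Fin N → Fin D → ℝ)) → ℝ) := by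
  have h1 : Continuous fun z : (Fin D → ℝ) × ((Fin N → ℝ) × (Fin N → Fin D → ℝ)) =>
      z.2.1 - Matrix.of z.2.2 *ᵥ z.1 :=
    (continuous_fst.comp continuous_snd).sub (continuous_mulVec_prod.comp
      (continuous_fst.prodMk (continuous_snd.comp continuous_snd)))
  have h2 : Continuous fun z : (Fin D → ℝ) × ((Fin N → ℝ) × (Fin N → Fin D → ℝ)) => z.2.2 :=
    continuous_snd.comp continuous_snd
  have h3 : Continuous fun z : (Fin D → ℝ) × ((Fin N → ℝ) × (Fin N → Fin D → ℝ)) => z.2.1 :=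
    continuous_fst.comp continuous_snd
  unfold likelihoodRatio
  exact ((continuous_regGram c).comp h2).matrix_det.sqrt.mul
    ((((h1.dotProduct h1).neg.div_const _).add ((h3.dotProduct
      (Continuous.matrix_mulVec ((continuous_regGram_inv hc).comp h2) h3)).div_const _)).rexp)

/-- The powers of 2π and of `v` are the same in both Gaussian densities and cancel; only the
determinant of I + cXXᵀ and the exponents survive in the ratio. -/
lemma density_eq_mul_likelihoodRatio {v c : ℝ} (hv : 0 < v) (hc : 0 ≤ c) (b : Fin D → ℝ)
    (y : Fin N → ℝ) (X : Fin N → Fin D → ℝ) :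
    centredGaussianDensity (v • (1 : Matrix (Fin N) (Fin N) ℝ)) (y - Matrix.of X *ᵥ b) =
      centredGaussianDensity (v • regGram c X) y * likelihoodRatio v c (b, (y, X)) := by
  have hdet := (regGram_posDef hc X).det_pos
  have hinv : ∀ M : Matrix (Fin N) (Fin N) ℝ, M.det ≠ 0 → (v • M)⁻¹ = v⁻¹ • M⁻¹ := fun M hM => by
    have := Matrix.inv_smul' M (Units.mk0 v hv.ne') hM.isUnit
    simpa [Units.smul_def] using this
  have hs : √(regGram c X).det ≠ 0 := (Real.sqrt_pos.2 hdet).ne'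
  have hvN : √(v ^ N) ≠ 0 := (Real.sqrt_pos.2 (pow_pos hv N)).ne'
  simp only [centredGaussianDensity, likelihoodRatio, hinv _ hdet.ne', Matrix.det_smul,
    hinv 1 (by simp), inv_one, Matrix.det_one, mul_one, Fintype.card_fin, Matrix.smul_mulVec,
    Matrix.one_mulVec, dotProduct_smul, smul_eq_mul]
  rw [Real.sqrt_mul (pow_pos hv N).le]
  have : ∀ a q : ℝ, Real.exp (-(v⁻¹ * a) / 2) =
      Real.exp (-(v⁻¹ * q) / 2) * Real.exp (-a / (2 * v) + q / (2 * v)) := fun a q => by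
    rw [← Real.exp_add]; congr 1; field_simp; ring
  rw [this _ (y ⬝ᵥ ((regGram c X)⁻¹ *ᵥ y))]
  field_simp

lemma measurable_channel :
    Measurable fun ω : (Fin D → ℝ) × ((Fin N → Fin D → ℝ) × (Fin N → ℝ)) =>
      (ω.1, (Matrix.of ω.2.1 *ᵥ ω.1 + ω.2.2, ω.2.1)) := by
  refine Continuous.measurable (continuous_fst.prodMk (Continuous.prodMk (Continuous.add ?_ ?_) ?_))
  · exact continuous_mulVec_prod.comp
      (continuous_fst.prodMk (continuous_fst.comp continuous_snd))
  · exact continuous_snd.comp continuous_snd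
  · exact continuous_fst.comp continuous_snd

lemma continuous_centredGaussianDensity_one (v : ℝ) :
    Continuous (centredGaussianDensity (v • (1 : Matrix (Fin N) (Fin N) ℝ))) := by
  unfold centredGaussianDensity dotProduct Matrix.mulVec dotProduct; fun_prop

lemma measurable_density_regGram {v c : ℝ} (hv : 0 < v) (hc : 0 ≤ c) :
    Measurable fun z : (Fin N → ℝ) × (Fin N → Fin D → ℝ) =>
      ENNReal.ofReal (centredGaussianDensity (v • regGram c z.2) z.1) := by
  -- At input 0 the density is a quotient of two continuous functions, which settles joint
  -- measurability in y and X.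
  have h : ∀ z : (Fin N → ℝ) × (Fin N → Fin D → ℝ),
      centredGaussianDensity (v • regGram c z.2) z.1 =
      centredGaussianDensity (v • (1 : Matrix (Fin N) (Fin N) ℝ)) z.1 /
        likelihoodRatio v c ((0 : Fin D → ℝ), z) := fun z => by
    rw [eq_div_iff (likelihoodRatio_pos hc _).ne', ← density_eq_mul_likelihoodRatio hv hc]
    simp
  simp_rw [h]
  refine (Measurable.div ?_ ?_).ennreal_ofReal
  · exact ((continuous_centredGaussianDensity_one v).comp continuous_fst).measurable
  · exact ((continuous_likelihoodRatio v hc).comp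
      (continuous_const.prodMk continuous_id)).measurable

instance isProbabilityMeasure_channelJointLaw (σ : ℝ) (ν : Measure (Fin D → ℝ))
    [IsProbabilityMeasure ν] : IsProbabilityMeasure (channelJointLaw N D σ ν) :=
  Measure.isProbabilityMeasure_map measurable_channel.aemeasurable

lemma fst_channelJointLaw (σ : ℝ) (ν : Measure (Fin D → ℝ)) [IsProbabilityMeasure ν] :
    (channelJointLaw N D σ ν).fst = ν := by
  rw [channelJointLaw, Measure.fst, Measure.map_map measurable_fst measurable_channel]
  exact Measure.fst_prod

lemma lintegral_channelJointLaw {σ : ℝ} (ν : Measure (Fin D → ℝ)) [SFinite ν]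
    {F : (Fin D → ℝ) × ((Fin N → ℝ) × (Fin N → Fin D → ℝ)) → ℝ≥0∞} (hF : Measurable F) :
    ∫⁻ z, F z ∂(channelJointLaw N D σ ν) = ∫⁻ b, ∫⁻ X, ∫⁻ e,
      F (b, (Matrix.of X *ᵥ b + e, X)) ∂(noiseLaw N σ) ∂(gaussianMatrixLaw N D) ∂ν := by
  have hFm : Measurable fun ω : (Fin D → ℝ) × ((Fin N → Fin D → ℝ) × (Fin N → ℝ)) =>
    F (ω.1, (Matrix.of ω.2.1 *ᵥ ω.1 + ω.2.2, ω.2.1)) := hF.comp measurable_channel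
  rw [channelJointLaw, lintegral_map hF measurable_channel, lintegral_prod _ hFm.aemeasurable]
  refine lintegral_congr fun b => ?_
  exact lintegral_prod _ (hFm.comp measurable_prodMk_left).aemeasurable

variable {P σ : ℝ}

lemma channelJointLaw_eq_withDensity (hσ : 0 < σ) (ν : Measure (Fin D → ℝ)) [SFinite ν] :
    channelJointLaw N D σ ν = (ν.prod (volume.prod (gaussianMatrixLaw N D))).withDensity
      fun z => ENNReal.ofReal (centredGaussianDensity (σ ^ 2 • (1 : Matrix (Fin N) (Fin N) ℝ))
        (z.2.1 - Matrix.of z.2.2 *ᵥ z.1)) := by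
  have hden : Measurable fun z : (Fin D → ℝ) × ((Fin N → ℝ) × (Fin N → Fin D → ℝ)) =>
      ENNReal.ofReal (centredGaussianDensity (σ ^ 2 • (1 : Matrix (Fin N) (Fin N) ℝ))
        (z.2.1 - Matrix.of z.2.2 *ᵥ z.1)) :=
    ((continuous_centredGaussianDensity_one _).comp ((continuous_fst.comp continuous_snd).sub
      (continuous_mulVec_prod.comp (continuous_fst.prodMk
        (continuous_snd.comp continuous_snd))))).measurable.ennreal_ofReal
  have hden' : Measurable fun y : Fin N → ℝ => ENNReal.ofReal
      (centredGaussianDensity (σ ^ 2 • (1 : Matrix (Fin N) (Fin N) ℝ)) y) :=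
    (continuous_centredGaussianDensity_one _).measurable.ennreal_ofReal
  refine Measure.ext_of_lintegral _ fun F hF => ?_
  have hdF := hden.mul hF
  rw [lintegral_channelJointLaw ν hF, lintegral_withDensity_eq_lintegral_mul _ hden hF,
    lintegral_prod _ hdF.aemeasurable]
  refine lintegral_congr fun b => ?_
  refine Eq.trans ?_ (lintegral_prod_symm _ (hdF.comp measurable_prodMk_left).aemeasurable).symm
  refine lintegral_congr fun X => ?_
  have hnoise : noiseLaw N σ = volume.withDensity fun y => ENNReal.ofReal
      (centredGaussianDensity (σ ^ 2 • (1 : Matrix (Fin N) (Fin N) ℝ)) y) := by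
    have := pi_gaussianReal_eq_withDensity_of_pos (m := Fin N) (σ ^ 2).toNNReal
      (Real.toNNReal_pos.2 (by positivity))
    rwa [Real.coe_toNNReal _ (by positivity)] at this
  have hFX : Measurable fun e => F (b, (Matrix.of X *ᵥ b + e, X)) :=
    hF.comp (measurable_const.prodMk ((measurable_const.add measurable_id).prodMk
      measurable_const))
  rw [hnoise, lintegral_withDensity_eq_lintegral_mul _ hden' hFX]
  -- Translation invariance of Lebesgue measure turns the noise density at e into the density at y −
  -- Xb.
  refine Eq.trans ?_ (lintegral_add_left_eq_self _ (Matrix.of X *ᵥ b))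
  refine lintegral_congr fun e => ?_
  simp

/-- Exchange the integrals over β and X so that X is frozen; y is then Gaussian with covariance
(P/D)XXᵀ + σ²I. -/
lemma snd_channelJointLaw_gaussian (hP : 0 ≤ P) (hσ : 0 < σ) :
    (channelJointLaw N D σ (Measure.pi fun _ => gaussianReal 0 (P / D).toNNReal)).snd =
      (volume.prod (gaussianMatrixLaw N D)).withDensity fun z => ENNReal.ofReal
        (centredGaussianDensity (σ ^ 2 • regGram (P / σ ^ 2 / D) z.2) z.1) := by
  have hden := measurable_density_regGram (N := N) (D := D) (v := σ ^ 2) (c := P / σ ^ 2 / D)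
    (by positivity) (by positivity)
  refine Measure.ext_of_lintegral _ fun F hF => ?_
  rw [Measure.snd, lintegral_map hF measurable_snd,
    lintegral_channelJointLaw _ (show Measurable fun z : (Fin D → ℝ) ×
      ((Fin N → ℝ) × (Fin N → Fin D → ℝ)) => F z.2 from hF.comp measurable_snd),
    lintegral_withDensity_eq_lintegral_mul _ hden hF,
    lintegral_prod_symm _ (hden.mul hF).aemeasurable]
  have hm := (hF.comp measurable_snd).comp (measurable_channel (N := N) (D := D))
  have hm2 : Measurable fun p : (Fin D → ℝ) × (Fin N → Fin D → ℝ) =>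
      ∫⁻ e, F (Matrix.of p.2 *ᵥ p.1 + e, p.2) ∂(noiseLaw N σ) := by
    have hq : Measurable fun q : ((Fin D → ℝ) × (Fin N → Fin D → ℝ)) × (Fin N → ℝ) =>
        F (Matrix.of q.1.2 *ᵥ q.1.1 + q.2, q.1.2) := hm.comp MeasurableEquiv.prodAssoc.measurable
    exact hq.lintegral_prod_right'
  refine (lintegral_lintegral_swap hm2.aemeasurable).trans (lintegral_congr fun X => ?_)
  have hmap := map_mulVec_add_eq_withDensity (Matrix.of X) (P / D).toNNReal (σ ^ 2).toNNReal
      (Real.toNNReal_pos.2 (by positivity))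
  rw [Real.coe_toNNReal _ (by positivity), Real.coe_toNNReal _ (by positivity),
    show P / D / σ ^ 2 = P / σ ^ 2 / D by ring] at hmap
  have hFX : Measurable fun y => F (y, X) := hF.comp measurable_prodMk_right
  have hlin : Measurable fun z : (Fin D → ℝ) × (Fin N → ℝ) => Matrix.of X *ᵥ z.1 + z.2 :=
    ((Continuous.matrix_mulVec continuous_const continuous_fst).add continuous_snd).measurable
  have h1 := lintegral_map (μ := (Measure.pi fun _ : Fin D => gaussianReal 0 (P / D).toNNReal).prod
    (noiseLaw N σ)) hFX hlin
  refine ((lintegral_prod _ (hFX.comp hlin).aemeasurable).symm.trans h1.symm).trans ?_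
  rw [noiseLaw, hmap]
  exact lintegral_withDensity_eq_lintegral_mul _ (hden.comp measurable_prodMk_right) hFX

/-- Both laws have densities with respect to ν ⊗ Lebesgue ⊗ (law of X), and the quotient of the
densities is the likelihood ratio. -/
lemma channelJointLaw_eq_withDensity_likelihoodRatio (hP : 0 ≤ P) (hσ : 0 < σ)
    (ν : Measure (Fin D → ℝ)) [SFinite ν] :
    channelJointLaw N D σ ν = (ν.prod (channelJointLaw N D σ
      (Measure.pi fun _ => gaussianReal 0 (P / D).toNNReal)).snd).withDensity
        fun z => ENNReal.ofReal (likelihoodRatio (σ ^ 2) (P / σ ^ 2 / D) z) := by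
  have hc : 0 ≤ P / σ ^ 2 / D := by positivity
  have hden := measurable_density_regGram (N := N) (D := D) (v := σ ^ 2) (c := P / σ ^ 2 / D)
    (by positivity) hc
  rw [snd_channelJointLaw_gaussian hP hσ, prod_withDensity_right hden,
    ← withDensity_mul _ (show Measurable fun z : (Fin D → ℝ) × ((Fin N → ℝ) × (Fin N → Fin D → ℝ)) =>
      ENNReal.ofReal (centredGaussianDensity (σ ^ 2 • regGram (P / σ ^ 2 / D) z.2.2) z.2.1) from
      hden.comp measurable_snd)
      (continuous_likelihoodRatio _ hc).measurable.ennreal_ofReal,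
    channelJointLaw_eq_withDensity hσ]
  congr 1
  ext z
  rw [density_eq_mul_likelihoodRatio (by positivity) hc, Pi.mul_apply, ENNReal.ofReal_mul]
  unfold centredGaussianDensity
  positivity

end Densities

/-! ### Symmetries and second moments of Gaussian vectors. -/

section Moments

variable {ι : Type*} [Fintype ι]

lemma measurePreserving_sign_pi_gaussianReal (v : NNReal) (s : ι → ℝ) (hs : ∀ i, s i ^ 2 = 1) :
    MeasurePreserving (fun (x : ι → ℝ) i => s i * x i)
      (Measure.pi fun _ : ι => gaussianReal 0 v) (Measure.pi fun _ : ι => gaussianReal 0 v) := by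
  refine measurePreserving_pi _ _ (f := fun i x => s i * x) fun i =>
    ⟨measurable_const_mul _, ?_⟩
  rw [gaussianReal_map_const_mul]
  congr 1
  · simp
  · ext; simp [hs i]

lemma measurePreserving_perm_pi (μ : Measure ℝ) [SigmaFinite μ] (e : Equiv.Perm ι) :
    MeasurePreserving (fun (x : ι → ℝ) i => x (e i))
      (Measure.pi fun _ : ι => μ) (Measure.pi fun _ : ι => μ) := by
  have h := measurePreserving_piCongrLeft (fun _ : ι => μ) e.symm
  convert h using 1
  ext x i
  have := Equiv.piCongrLeft_apply_apply (fun _ : ι => ℝ) e.symm x (e i)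
  simp only [Equiv.symm_apply_apply] at this
  exact this.symm

lemma integrable_sq_gaussianReal (v : NNReal) : Integrable (fun x => x ^ 2) (gaussianReal 0 v) :=
  (memLp_id_gaussianReal 2).integrable_sq

lemma integral_sq_gaussianReal (v : NNReal) : ∫ x, x ^ 2 ∂(gaussianReal 0 v) = v := by
  have h := variance_id_gaussianReal (μ := 0) (v := v)
  rw [variance_eq_integral measurable_id.aemeasurable] at h
  simpa using h

lemma integrable_sq_pi_gaussianReal (v : NNReal) (i : ι) :
    Integrable (fun x : ι → ℝ => x i ^ 2) (Measure.pi fun _ : ι => gaussianReal 0 v) :=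
  integrable_comp_eval (μ := fun _ : ι => gaussianReal 0 v) (i := i) (f := fun t : ℝ => t ^ 2)
    (integrable_sq_gaussianReal v)

lemma integral_sq_pi_gaussianReal (v : NNReal) (i : ι) :
    ∫ x : ι → ℝ, x i ^ 2 ∂(Measure.pi fun _ : ι => gaussianReal 0 v) = v := by
  rw [integral_comp_eval (μ := fun _ : ι => gaussianReal 0 v) (i := i)
    (f := fun t : ℝ => t ^ 2) (by fun_prop), integral_sq_gaussianReal]

lemma integrable_mul_pi_gaussianReal (v : NNReal) (i j : ι) :
    Integrable (fun x : ι → ℝ => x i * x j) (Measure.pi fun _ : ι => gaussianReal 0 v) := by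
  refine ((integrable_sq_pi_gaussianReal v i).add (integrable_sq_pi_gaussianReal v j)).mono'
    (by fun_prop) (Filter.Eventually.of_forall fun x => ?_)
  rw [Real.norm_eq_abs, abs_le, Pi.add_apply]
  constructor <;> nlinarith [sq_nonneg (x i + x j), sq_nonneg (x i - x j), sq_nonneg (x i),
    sq_nonneg (x j)]

lemma integral_mul_pi_gaussianReal [DecidableEq ι] (v : NNReal) (i j : ι) :
    ∫ x : ι → ℝ, x i * x j ∂(Measure.pi fun _ : ι => gaussianReal 0 v) =
      if i = j then (v : ℝ) else 0 := by
  split_ifs with h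
  · subst h
    simp_rw [← pow_two]
    exact integral_sq_pi_gaussianReal v i
  -- Flipping the sign of coordinate i preserves the law and negates the product.
  · have hp := measurePreserving_sign_pi_gaussianReal v (fun k => if k = i then -1 else 1)
      (fun k => by split_ifs <;> norm_num)
    have h1 := integral_map (μ := Measure.pi fun _ : ι => gaussianReal 0 v)
      hp.measurable.aemeasurable (f := fun x : ι → ℝ => x i * x j) (by fun_prop)
    rw [hp.map_eq] at h1
    simp only [if_true, if_neg (Ne.symm h), one_mul, neg_mul, integral_neg] at h1
    linarith

lemma integral_dotProduct_mulVec_pi_gaussianReal (v : NNReal) (M : Matrix ι ι ℝ) :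
    ∫ x : ι → ℝ, x ⬝ᵥ (M *ᵥ x) ∂(Measure.pi fun _ : ι => gaussianReal 0 v) = v * M.trace := by
  classical
  have h : ∀ x : ι → ℝ, x ⬝ᵥ (M *ᵥ x) = ∑ i, ∑ j, M i j * (x i * x j) := fun x => by
    simp only [dotProduct, Matrix.mulVec, Finset.mul_sum]
    exact Finset.sum_congr rfl fun i _ => Finset.sum_congr rfl fun j _ => by ring
  have hint : ∀ i j, Integrable (fun x : ι → ℝ => M i j * (x i * x j))
    (Measure.pi fun _ : ι => gaussianReal 0 v) :=
    fun i j => (integrable_mul_pi_gaussianReal v i j).const_mul _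
  rw [integral_congr_ae (Filter.Eventually.of_forall h),
    integral_finsetSum _ fun i _ => integrable_finsetSum _ fun j _ => hint i j]
  simp_rw [integral_finsetSum _ fun j _ => hint _ j, integral_const_mul,
    integral_mul_pi_gaussianReal]
  simp [Matrix.trace, Finset.mul_sum, mul_comm]

lemma integrable_dotProduct_self_pi_gaussianReal (v : NNReal) :
    Integrable (fun x : ι → ℝ => x ⬝ᵥ x) (Measure.pi fun _ : ι => gaussianReal 0 v) :=
  integrable_finsetSum _ fun i _ => integrable_mul_pi_gaussianReal v i i

end Moments

/-! ### Symmetries and moments of the Gaussian matrix. -/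

section MatrixMoments

variable {N D : ℕ}

lemma measurePreserving_sign_gaussianMatrixLaw (s : Fin D → ℝ) (hs : ∀ k, s k ^ 2 = 1) :
    MeasurePreserving (fun (X : Fin N → Fin D → ℝ) i k => s k * X i k)
      (gaussianMatrixLaw N D) (gaussianMatrixLaw N D) :=
  measurePreserving_pi _ _ fun _ => measurePreserving_sign_pi_gaussianReal 1 s hs

lemma measurePreserving_perm_gaussianMatrixLaw (e : Equiv.Perm (Fin D)) :
    MeasurePreserving (fun (X : Fin N → Fin D → ℝ) i k => X i (e k))
      (gaussianMatrixLaw N D) (gaussianMatrixLaw N D) :=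
  measurePreserving_pi _ _ fun _ => measurePreserving_perm_pi _ e

lemma integrable_sq_gaussianMatrixLaw (i : Fin N) (k : Fin D) :
    Integrable (fun X => X i k ^ 2) (gaussianMatrixLaw N D) :=
  integrable_comp_eval (μ := fun _ : Fin N => Measure.pi fun _ : Fin D => gaussianReal 0 1)
    (i := i) (f := fun x : Fin D → ℝ => x k ^ 2) (integrable_sq_pi_gaussianReal 1 k)

lemma integral_sq_gaussianMatrixLaw (i : Fin N) (k : Fin D) :
    ∫ X, X i k ^ 2 ∂(gaussianMatrixLaw N D) = 1 := by
  rw [gaussianMatrixLaw, integral_comp_eval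
    (μ := fun _ : Fin N => Measure.pi fun _ : Fin D => gaussianReal 0 1)
    (i := i) (f := fun x : Fin D → ℝ => x k ^ 2)
    (Continuous.aestronglyMeasurable (by fun_prop)), integral_sq_pi_gaussianReal, NNReal.coe_one]

/-- The matrix `Xᵀ (I + c X Xᵀ)⁻¹ X`. -/
noncomputable def sandwich (c : ℝ) (X : Fin N → Fin D → ℝ) : Matrix (Fin D) (Fin D) ℝ :=
  (Matrix.of X)ᵀ * (regGram c X)⁻¹ * Matrix.of X

lemma sandwich_apply (c : ℝ) (X : Fin N → Fin D → ℝ) (j k : Fin D) :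
    sandwich c X j k = (fun i => X i j) ⬝ᵥ ((regGram c X)⁻¹ *ᵥ fun i => X i k) := by
  rw [sandwich, Matrix.mul_assoc, Matrix.mul_apply]
  rfl

lemma continuous_sandwich {c : ℝ} (hc : 0 ≤ c) :
    Continuous (sandwich c : (Fin N → Fin D → ℝ) → _) := by
  unfold sandwich
  exact Continuous.matrix_mul (Continuous.matrix_mul (Continuous.matrix_transpose continuous_id)
    (continuous_regGram_inv hc)) continuous_id

lemma mulVec_dotProduct_inv_mulVec (c : ℝ) (X : Fin N → Fin D → ℝ) (b : Fin D → ℝ) :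
    (Matrix.of X *ᵥ b) ⬝ᵥ ((regGram c X)⁻¹ *ᵥ (Matrix.of X *ᵥ b)) =
      b ⬝ᵥ (sandwich c X *ᵥ b) := by
  rw [sandwich, ← Matrix.mulVec_mulVec, ← Matrix.mulVec_mulVec, Matrix.dotProduct_mulVec b,
    ← Matrix.mulVec_transpose, Matrix.transpose_transpose]

lemma dotProduct_regGram_inv_nonneg {c : ℝ} (hc : 0 ≤ c) (X : Fin N → Fin D → ℝ)
    (u : Fin N → ℝ) : 0 ≤ u ⬝ᵥ ((regGram c X)⁻¹ *ᵥ u) :=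
  dotProduct_inv_mulVec_nonneg (regGram_posDef hc X) u

lemma dotProduct_regGram_inv_le {c : ℝ} (hc : 0 ≤ c) (X : Fin N → Fin D → ℝ)
    (u : Fin N → ℝ) : u ⬝ᵥ ((regGram c X)⁻¹ *ᵥ u) ≤ u ⬝ᵥ u :=
  dotProduct_inv_mulVec_le hc _ u

lemma regGram_inv_symm {c : ℝ} (hc : 0 ≤ c) (X : Fin N → Fin D → ℝ) (u w : Fin N → ℝ) :
    u ⬝ᵥ ((regGram c X)⁻¹ *ᵥ w) = w ⬝ᵥ ((regGram c X)⁻¹ *ᵥ u) := by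
  have hT : ((regGram c X)⁻¹)ᵀ = (regGram c X)⁻¹ := by
    simpa [Matrix.IsHermitian] using (regGram_posDef hc X).inv.1.eq
  rw [Matrix.dotProduct_mulVec, ← Matrix.mulVec_transpose, hT, dotProduct_comm]

/-- Nonnegativity of the form at u ± w, for the columns u and w, bounds the entry by the diagonal
entries, and these are at most |u|² and |w|². -/
lemma integrable_sandwich {c : ℝ} (hc : 0 ≤ c) (j k : Fin D) :
    Integrable (fun X : Fin N → Fin D → ℝ => sandwich c X j k) (gaussianMatrixLaw N D) := by
  have hcol : ∀ j : Fin D, Integrable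
      (fun X : Fin N → Fin D → ℝ => (fun i => X i j) ⬝ᵥ fun i => X i j) (gaussianMatrixLaw N D) :=
    fun j => integrable_finsetSum _ fun i _ => by
      simpa [pow_two] using integrable_sq_gaussianMatrixLaw i j
  refine ((hcol j).add (hcol k)).mono'
    ((continuous_sandwich hc).matrix_elem j k).aestronglyMeasurable
    (Filter.Eventually.of_forall fun X => ?_)
  rw [Real.norm_eq_abs, sandwich_apply, Pi.add_apply]
  set u : Fin N → ℝ := fun i => X i j
  set w : Fin N → ℝ := fun i => X i k
  have h1 := dotProduct_regGram_inv_nonneg hc X (u + w)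
  have h2 := dotProduct_regGram_inv_nonneg hc X (u - w)
  have h3 := dotProduct_regGram_inv_le hc X u
  have h4 := dotProduct_regGram_inv_le hc X w
  have h5 := dotProduct_regGram_inv_nonneg hc X u
  have h6 := dotProduct_regGram_inv_nonneg hc X w
  simp only [Matrix.mulVec_add, Matrix.mulVec_sub, add_dotProduct, sub_dotProduct, dotProduct_add,
    dotProduct_sub, regGram_inv_symm hc X w u] at h1 h2
  rw [abs_le]
  constructor <;> linarith

/-- Changing the sign of column j fixes XXᵀ and negates the (j, k) entry, while the law of X is
unchanged. -/
lemma integral_sandwich_of_ne {c : ℝ} (hc : 0 ≤ c) {j k : Fin D} (hjk : j ≠ k) :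
    ∫ X : Fin N → Fin D → ℝ, sandwich c X j k ∂(gaussianMatrixLaw N D) = 0 := by
  set s : Fin D → ℝ := fun l => if l = j then -1 else 1 with hs
  have hs2 : ∀ l, s l ^ 2 = 1 := fun l => by simp only [hs]; split_ifs <;> norm_num
  have hp := measurePreserving_sign_gaussianMatrixLaw (N := N) s hs2
  have h1 := integral_map (μ := gaussianMatrixLaw N D) hp.measurable.aemeasurable
    (f := fun X : Fin N → Fin D → ℝ => sandwich c X j k)
    ((continuous_sandwich hc).matrix_elem j k).aestronglyMeasurable
  rw [hp.map_eq] at h1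
  have h2 : ∀ X : Fin N → Fin D → ℝ,
      sandwich c (fun i l => s l * X i l) j k = -sandwich c X j k := fun X => by
    have hg : regGram c (fun i l => s l * X i l) = regGram c X := by
      unfold regGram
      congr 2
      ext a b
      simp only [Matrix.mul_apply, Matrix.transpose_apply, Matrix.of_apply]
      exact Finset.sum_congr rfl fun l _ => by linear_combination (X a l * X b l) * hs2 l
    rw [sandwich_apply, sandwich_apply, hg]
    have ej : (fun i => s j * X i j) = -fun i => X i j := by ext i; simp [hs]
    have ek : (fun i => s k * X i k) = fun i => X i k := by ext i; simp [hs, hjk.symm]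
    rw [ej, ek, neg_dotProduct]
  simp_rw [h2, integral_neg] at h1
  linarith

lemma integral_sandwich_diag {c : ℝ} (hc : 0 ≤ c) (j k : Fin D) :
    ∫ X : Fin N → Fin D → ℝ, sandwich c X j j ∂(gaussianMatrixLaw N D) =
      ∫ X : Fin N → Fin D → ℝ, sandwich c X k k ∂(gaussianMatrixLaw N D) := by
  set e := Equiv.swap j k with he
  have hp := measurePreserving_perm_gaussianMatrixLaw (N := N) e
  have h1 := integral_map (μ := gaussianMatrixLaw N D) hp.measurable.aemeasurable
    (f := fun X : Fin N → Fin D → ℝ => sandwich c X j j)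
    ((continuous_sandwich hc).matrix_elem j j).aestronglyMeasurable
  rw [hp.map_eq] at h1
  rw [h1]
  congr 1
  ext X
  have hg : regGram c (fun i l => X i (e l)) = regGram c X := by
    unfold regGram
    congr 2
    ext a b
    simp only [Matrix.mul_apply, Matrix.transpose_apply, Matrix.of_apply]
    exact Equiv.sum_comp e fun l => X a l * X b l
  rw [sandwich_apply, sandwich_apply, hg]
  simp [he]

/-- The expected sandwich matrix has zero off-diagonal entries and equal diagonal ones, so it is
(trace/D) I. This is why a constraint on E|β|² alone controls the divergence. -/
lemma integral_dotProduct_sandwich {c : ℝ} (hc : 0 ≤ c) (hD : 0 < D) (b : Fin D → ℝ) :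
    ∫ X : Fin N → Fin D → ℝ, b ⬝ᵥ (sandwich c X *ᵥ b) ∂(gaussianMatrixLaw N D) =
      (∫ X : Fin N → Fin D → ℝ, (sandwich c X).trace ∂(gaussianMatrixLaw N D)) / D * (b ⬝ᵥ b) := by
  have hint := integrable_sandwich (N := N) (D := D) hc
  have htr : ∀ k, ∫ X : Fin N → Fin D → ℝ, (sandwich c X).trace ∂(gaussianMatrixLaw N D) =
      D * ∫ X : Fin N → Fin D → ℝ, sandwich c X k k ∂(gaussianMatrixLaw N D) := fun k => by
    simp only [Matrix.trace, Matrix.diag]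
    rw [integral_finsetSum _ fun i _ => hint i i, Finset.sum_congr rfl fun i _ =>
      integral_sandwich_diag hc i k]
    simp
  have h : ∀ X : Fin N → Fin D → ℝ, b ⬝ᵥ (sandwich c X *ᵥ b) =
      ∑ j, ∑ k, b j * b k * sandwich c X j k := fun X => by
    simp only [dotProduct, Matrix.mulVec, Finset.mul_sum]
    exact Finset.sum_congr rfl fun i _ => Finset.sum_congr rfl fun j _ => by ring
  simp_rw [h]
  rw [integral_finsetSum _ fun i _ => integrable_finsetSum _ fun j _ => (hint i j).const_mul _]
  simp_rw [integral_finsetSum _ fun j _ => (hint _ j).const_mul _, integral_const_mul]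
  rw [dotProduct, Finset.mul_sum]
  refine Finset.sum_congr rfl fun j _ => ?_
  rw [Finset.sum_eq_single j (fun k _ hk => by rw [integral_sandwich_of_ne hc hk.symm, mul_zero])
    (by simp), htr j]
  have : (D : ℝ) ≠ 0 := by positivity
  field_simp

lemma trace_mul_transpose_eq_sum (X : Fin N → Fin D → ℝ) :
    (Matrix.of X * (Matrix.of X)ᵀ).trace = ∑ i, ∑ k, X i k ^ 2 := by
  simp [Matrix.trace, Matrix.mul_apply, pow_two]

lemma integrable_sum_sq_gaussianMatrixLaw :
    Integrable (fun X : Fin N → Fin D → ℝ => ∑ i, ∑ k, X i k ^ 2) (gaussianMatrixLaw N D) :=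
  integrable_finsetSum _ fun i _ => integrable_finsetSum _ fun k _ =>
    integrable_sq_gaussianMatrixLaw i k

lemma integral_sum_sq_gaussianMatrixLaw :
    ∫ X : Fin N → Fin D → ℝ, ∑ i, ∑ k, X i k ^ 2 ∂(gaussianMatrixLaw N D) = N * D := by
  rw [integral_finsetSum _ fun i _ => integrable_finsetSum _ fun k _ =>
    integrable_sq_gaussianMatrixLaw i k]
  simp_rw [integral_finsetSum _ fun k _ => integrable_sq_gaussianMatrixLaw _ k,
    integral_sq_gaussianMatrixLaw]
  simp

lemma integrable_log_det_regGram {c : ℝ} (hc : 0 ≤ c) :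
    Integrable (fun X : Fin N → Fin D → ℝ => Real.log (regGram c X).det)
      (gaussianMatrixLaw N D) := by
  refine (integrable_sum_sq_gaussianMatrixLaw.const_mul c).mono'
    (continuous_log_det_regGram hc).aestronglyMeasurable (Filter.Eventually.of_forall fun X => ?_)
  rw [Real.norm_eq_abs, abs_of_nonneg (show 0 ≤ Real.log (regGram c X).det from
    log_det_one_add_nonneg hc _)]
  have := (regGram_posDef hc X).log_det_le one_pos
  rw [regGram, Matrix.trace_add, Matrix.trace_one, Matrix.trace_smul,
    trace_mul_transpose_eq_sum] at this
  simp only [Real.log_one, mul_zero, div_one, zero_add, smul_eq_mul, add_sub_cancel_left] at this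
  exact this

end MatrixMoments

/-! ### Computation of the capacity. -/

section Capacity

variable {N D : ℕ}

lemma mulVec_dotProduct_self_le (X : Fin N → Fin D → ℝ) (b : Fin D → ℝ) :
    (Matrix.of X *ᵥ b) ⬝ᵥ (Matrix.of X *ᵥ b) ≤ (b ⬝ᵥ b) * ∑ i, ∑ k, X i k ^ 2 := by
  rw [dotProduct, Finset.mul_sum]
  refine Finset.sum_le_sum fun i _ => ?_
  have := Finset.sum_mul_sq_le_sq_mul_sq Finset.univ (X i) b
  simp only [Matrix.mulVec, dotProduct, Matrix.of_apply, ← pow_two]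
  linarith

lemma measurePreserving_neg_noiseLaw (σ : ℝ) :
    MeasurePreserving (fun e : Fin N → ℝ => -e) (noiseLaw N σ) (noiseLaw N σ) := by
  have := measurePreserving_sign_pi_gaussianReal (ι := Fin N) (σ ^ 2).toNNReal (fun _ => -1)
    (fun _ => by norm_num)
  simp only [neg_one_mul] at this
  exact this

variable {P σ : ℝ} {ν : Measure (Fin D → ℝ)}

lemma integrable_signal_sq (hν : Integrable (fun b => b ⬝ᵥ b) ν) :
    Integrable (fun ω : (Fin D → ℝ) × ((Fin N → Fin D → ℝ) × (Fin N → ℝ)) =>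
      (Matrix.of ω.2.1 *ᵥ ω.1) ⬝ᵥ (Matrix.of ω.2.1 *ᵥ ω.1))
      (ν.prod ((gaussianMatrixLaw N D).prod (noiseLaw N σ))) := by
  have hX : Integrable (fun z : (Fin N → Fin D → ℝ) × (Fin N → ℝ) => ∑ i, ∑ k, z.1 i k ^ 2)
      ((gaussianMatrixLaw N D).prod (noiseLaw N σ)) :=
    (integrable_sum_sq_gaussianMatrixLaw (N := N) (D := D)).comp_fst _
  have hc : Continuous fun ω : (Fin D → ℝ) × ((Fin N → Fin D → ℝ) × (Fin N → ℝ)) =>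
      Matrix.of ω.2.1 *ᵥ ω.1 := continuous_mulVec_prod.comp
        (continuous_fst.prodMk (continuous_fst.comp continuous_snd))
  refine (hν.mul_prod hX).mono' (hc.dotProduct hc).aestronglyMeasurable
    (Filter.Eventually.of_forall fun ω => ?_)
  rw [Real.norm_eq_abs, abs_of_nonneg (Finset.sum_nonneg fun i _ => mul_self_nonneg _)]
  exact mulVec_dotProduct_self_le _ _

variable [IsProbabilityMeasure ν]

lemma integrable_noise_sq :
    Integrable (fun ω : (Fin D → ℝ) × ((Fin N → Fin D → ℝ) × (Fin N → ℝ)) => ω.2.2 ⬝ᵥ ω.2.2)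
      (ν.prod ((gaussianMatrixLaw N D).prod (noiseLaw N σ))) :=
  (((integrable_dotProduct_self_pi_gaussianReal (ι := Fin N) (σ ^ 2).toNNReal).comp_snd
    (gaussianMatrixLaw N D)).comp_snd ν)

lemma integrable_quadratic_of_le {c : ℝ} (hc : 0 ≤ c)
    {u : (Fin D → ℝ) × ((Fin N → Fin D → ℝ) × (Fin N → ℝ)) → Fin N → ℝ} (hu : Continuous u)
    {μ : Measure ((Fin D → ℝ) × ((Fin N → Fin D → ℝ) × (Fin N → ℝ)))}
    (hint : Integrable (fun ω => u ω ⬝ᵥ u ω) μ) :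
    Integrable (fun ω => u ω ⬝ᵥ ((regGram c ω.2.1)⁻¹ *ᵥ u ω)) μ := by
  refine hint.mono' (hu.dotProduct (Continuous.matrix_mulVec ((continuous_regGram_inv hc).comp
    (continuous_fst.comp continuous_snd)) hu)).aestronglyMeasurable
    (Filter.Eventually.of_forall fun ω => ?_)
  rw [Real.norm_eq_abs, abs_of_nonneg (dotProduct_regGram_inv_nonneg hc _ _)]
  exact dotProduct_regGram_inv_le hc _ _

lemma integrable_trace_regGram_inv {c : ℝ} (hc : 0 ≤ c) :
    Integrable (fun X : Fin N → Fin D → ℝ => ((regGram c X)⁻¹).trace) (gaussianMatrixLaw N D) ∧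
    ∫ X : Fin N → Fin D → ℝ, ((regGram c X)⁻¹).trace ∂(gaussianMatrixLaw N D) =
      N - c * ∫ X : Fin N → Fin D → ℝ, (sandwich c X).trace ∂(gaussianMatrixLaw N D) := by
  have hQ : Integrable (fun X : Fin N → Fin D → ℝ => (sandwich c X).trace)
      (gaussianMatrixLaw N D) := integrable_finsetSum _ fun i _ => integrable_sandwich hc i i
  have h : (fun X : Fin N → Fin D → ℝ => ((regGram c X)⁻¹).trace) =
      fun X => (N : ℝ) - c * (sandwich c X).trace := funext fun X => by
    have := trace_inv_add_smul_trace hc (Matrix.of X)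
    simp only [Fintype.card_fin] at this
    exact eq_sub_of_add_eq this
  rw [h]
  refine ⟨(integrable_const _).sub (hQ.const_mul c), ?_⟩
  rw [integral_sub (integrable_const _) (hQ.const_mul c), integral_const_mul]
  simp

lemma integral_quadratic_noise {c : ℝ} (hc : 0 ≤ c) :
    ∫ ω, ω.2.2 ⬝ᵥ ((regGram c ω.2.1)⁻¹ *ᵥ ω.2.2)
      ∂(ν.prod ((gaussianMatrixLaw N D).prod (noiseLaw N σ))) =
    σ ^ 2 * ∫ X : Fin N → Fin D → ℝ, ((regGram c X)⁻¹).trace ∂(gaussianMatrixLaw N D) := by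
  have hint := integrable_quadratic_of_le (u := fun ω => ω.2.2) hc (by fun_prop)
    (integrable_noise_sq (N := N) (σ := σ) (ν := ν))
  rw [integral_prod _ hint]
  have hint2 : Integrable (fun z : (Fin N → Fin D → ℝ) × (Fin N → ℝ) =>
      z.2 ⬝ᵥ ((regGram c z.1)⁻¹ *ᵥ z.2)) ((gaussianMatrixLaw N D).prod (noiseLaw N σ)) := by
    -- The integrand does not involve β, so integrability of a single section suffices.
    obtain ⟨b, hb⟩ := hint.prod_right_ae.exists
    exact hb
  simp only [integral_const, probReal_univ, one_smul]
  rw [integral_prod _ hint2, ← integral_const_mul]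
  congr 1
  ext X
  simp only
  rw [noiseLaw, integral_dotProduct_mulVec_pi_gaussianReal, Real.coe_toNNReal _ (sq_nonneg σ)]

lemma integral_quadratic_signal {c : ℝ} (hc : 0 ≤ c) (hD : 0 < D)
    (hν : Integrable (fun b => b ⬝ᵥ b) ν) :
    ∫ ω, (Matrix.of ω.2.1 *ᵥ ω.1) ⬝ᵥ ((regGram c ω.2.1)⁻¹ *ᵥ (Matrix.of ω.2.1 *ᵥ ω.1))
      ∂(ν.prod ((gaussianMatrixLaw N D).prod (noiseLaw N σ))) =
    (∫ X : Fin N → Fin D → ℝ, (sandwich c X).trace ∂(gaussianMatrixLaw N D)) / D *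
      ∫ b, b ⬝ᵥ b ∂ν := by
  have hu : Continuous fun ω : (Fin D → ℝ) × ((Fin N → Fin D → ℝ) × (Fin N → ℝ)) =>
      Matrix.of ω.2.1 *ᵥ ω.1 := continuous_mulVec_prod.comp
        (continuous_fst.prodMk (continuous_fst.comp continuous_snd))
  have hint := integrable_quadratic_of_le hc hu (integrable_signal_sq (σ := σ) hν)
  rw [integral_prod _ hint, ← integral_const_mul]
  congr 1
  ext b
  simp only
  rw [← integral_dotProduct_sandwich hc hD b]
  simp_rw [mulVec_dotProduct_inv_mulVec]
  rw [integral_fun_fst (fun X => b ⬝ᵥ (sandwich c X *ᵥ b))]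
  simp

lemma integral_quadratic_output {c : ℝ} (hc : 0 ≤ c) (hD : 0 < D)
    (hν : Integrable (fun b => b ⬝ᵥ b) ν) :
    Integrable (fun ω => (Matrix.of ω.2.1 *ᵥ ω.1 + ω.2.2) ⬝ᵥ
      ((regGram c ω.2.1)⁻¹ *ᵥ (Matrix.of ω.2.1 *ᵥ ω.1 + ω.2.2)))
      (ν.prod ((gaussianMatrixLaw N D).prod (noiseLaw N σ))) ∧
    ∫ ω, (Matrix.of ω.2.1 *ᵥ ω.1 + ω.2.2) ⬝ᵥ
      ((regGram c ω.2.1)⁻¹ *ᵥ (Matrix.of ω.2.1 *ᵥ ω.1 + ω.2.2))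
      ∂(ν.prod ((gaussianMatrixLaw N D).prod (noiseLaw N σ))) =
    (∫ X : Fin N → Fin D → ℝ, (sandwich c X).trace ∂(gaussianMatrixLaw N D)) / D *
      ∫ b, b ⬝ᵥ b ∂ν +
    σ ^ 2 * ∫ X : Fin N → Fin D → ℝ, ((regGram c X)⁻¹).trace ∂(gaussianMatrixLaw N D) := by
  set μ := ν.prod ((gaussianMatrixLaw N D).prod (noiseLaw N σ)) with hμ
  have hu : Continuous fun ω : (Fin D → ℝ) × ((Fin N → Fin D → ℝ) × (Fin N → ℝ)) =>
      Matrix.of ω.2.1 *ᵥ ω.1 := continuous_mulVec_prod.comp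
        (continuous_fst.prodMk (continuous_fst.comp continuous_snd))
  have he : Continuous fun ω : (Fin D → ℝ) × ((Fin N → Fin D → ℝ) × (Fin N → ℝ)) => ω.2.2 := by
    fun_prop
  have hsq := integrable_signal_sq (N := N) (σ := σ) hν
  have hnq := integrable_noise_sq (N := N) (σ := σ) (ν := ν)
  rw [← hμ] at hsq hnq
  have h1 := integrable_quadratic_of_le hc hu hsq
  have h2 := integrable_quadratic_of_le hc he hnq
  have hsum : Integrable (fun ω => (Matrix.of ω.2.1 *ᵥ ω.1 + ω.2.2) ⬝ᵥ
      (Matrix.of ω.2.1 *ᵥ ω.1 + ω.2.2)) μ := by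
    refine ((hsq.const_mul 2).add (hnq.const_mul 2)).mono'
      ((hu.add he).dotProduct (hu.add he)).aestronglyMeasurable
      (Filter.Eventually.of_forall fun ω => ?_)
    rw [Real.norm_eq_abs, abs_of_nonneg (Finset.sum_nonneg fun i _ => mul_self_nonneg _)]
    simp only [Pi.add_apply, dotProduct, Finset.mul_sum, ← Finset.sum_add_distrib]
    refine Finset.sum_le_sum fun i _ => ?_
    nlinarith [sq_nonneg ((Matrix.of ω.2.1 *ᵥ ω.1) i - ω.2.2 i)]
  have h3 := integrable_quadratic_of_le (u := fun ω => Matrix.of ω.2.1 *ᵥ ω.1 + ω.2.2) hc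
    (hu.add he) hsum
  refine ⟨h3, ?_⟩
  -- The noise is symmetric. Averaging the form over e and −e cancels the cross terms, which need
  -- not be integrated separately.
  have hflip : MeasurePreserving
      (fun ω : (Fin D → ℝ) × ((Fin N → Fin D → ℝ) × (Fin N → ℝ)) => (ω.1, (ω.2.1, -ω.2.2))) μ μ :=
    (MeasurePreserving.id ν).prod
      ((MeasurePreserving.id (gaussianMatrixLaw N D)).prod (measurePreserving_neg_noiseLaw σ))
  have h4 := integral_map (μ := μ) hflip.measurable.aemeasurable
    (by rw [hflip.map_eq]; exact h3.aestronglyMeasurable)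
  rw [hflip.map_eq] at h4
  have h3' := hflip.integrable_comp_of_integrable h3
  rw [← integral_quadratic_signal (σ := σ) hc hD hν, ← integral_quadratic_noise (ν := ν) hc, ← hμ,
    ← integral_add h1 h2]
  have h5 : ∀ ω : (Fin D → ℝ) × ((Fin N → Fin D → ℝ) × (Fin N → ℝ)),
      (Matrix.of ω.2.1 *ᵥ ω.1) ⬝ᵥ ((regGram c ω.2.1)⁻¹ *ᵥ (Matrix.of ω.2.1 *ᵥ ω.1)) +
        ω.2.2 ⬝ᵥ ((regGram c ω.2.1)⁻¹ *ᵥ ω.2.2) =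
      (1 / 2) * ((Matrix.of ω.2.1 *ᵥ ω.1 + ω.2.2) ⬝ᵥ
        ((regGram c ω.2.1)⁻¹ *ᵥ (Matrix.of ω.2.1 *ᵥ ω.1 + ω.2.2)) +
      (Matrix.of ω.2.1 *ᵥ ω.1 + -ω.2.2) ⬝ᵥ
        ((regGram c ω.2.1)⁻¹ *ᵥ (Matrix.of ω.2.1 *ᵥ ω.1 + -ω.2.2))) := fun ω => by
    simp only [Matrix.mulVec_add, Matrix.mulVec_neg, add_dotProduct, dotProduct_add,
      neg_dotProduct, dotProduct_neg]
    ring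
  rw [integral_congr_ae (Filter.Eventually.of_forall h5), integral_const_mul]
  have h6 := integral_add h3 h3'
  simp only [Function.comp_def] at h6
  rw [h6, ← h4]
  ring

/-- Let T be the expected trace of the sandwich matrix. The noise term contributes −N/2 and the
output form contributes (T/D · E|β|² + σ²(N − cT))/(2σ²). Since cσ² = P/D, the N/2 cancels and
T(E|β|² − P)/(2Dσ²) remains. -/
lemma klDiv_channelJointLaw (hD : 0 < D) (hP : 0 ≤ P) (hσ : 0 < σ)
    (hν : Integrable (fun b => b ⬝ᵥ b) ν) :
    klDiv (channelJointLaw N D σ ν) (ν.prod (channelJointLaw N D σ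
      (Measure.pi fun _ => gaussianReal 0 (P / D).toNNReal)).snd) =
    ENNReal.ofReal ((1 / 2) * ∫ X : Fin N → Fin D → ℝ,
        Real.log (regGram (P / σ ^ 2 / D) X).det ∂(gaussianMatrixLaw N D) +
      (∫ X : Fin N → Fin D → ℝ, (sandwich (P / σ ^ 2 / D) X).trace ∂(gaussianMatrixLaw N D)) /
        (2 * D * σ ^ 2) * ((∫ b, b ⬝ᵥ b ∂ν) - P)) := by
  set c := P / σ ^ 2 / D with hcdef
  have hc : 0 ≤ c := by positivity
  have hcont := continuous_likelihoodRatio (N := N) (D := D) (σ ^ 2) hc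
  have hlog : Continuous fun z => Real.log (likelihoodRatio (N := N) (D := D) (σ ^ 2) c z) :=
    hcont.log fun z => (likelihoodRatio_pos hc z).ne'
  set μ := ν.prod ((gaussianMatrixLaw N D).prod (noiseLaw N σ)) with hμ
  have hpt : ∀ ω : (Fin D → ℝ) × ((Fin N → Fin D → ℝ) × (Fin N → ℝ)),
      Real.log (likelihoodRatio (σ ^ 2) c (ω.1, (Matrix.of ω.2.1 *ᵥ ω.1 + ω.2.2, ω.2.1))) =
      (1 / 2) * Real.log (regGram c ω.2.1).det + (-1 / (2 * σ ^ 2)) * (ω.2.2 ⬝ᵥ ω.2.2) +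
      (1 / (2 * σ ^ 2)) * ((Matrix.of ω.2.1 *ᵥ ω.1 + ω.2.2) ⬝ᵥ
        ((regGram c ω.2.1)⁻¹ *ᵥ (Matrix.of ω.2.1 *ᵥ ω.1 + ω.2.2))) := fun ω => by
    rw [log_likelihoodRatio hc]
    simp only [add_sub_cancel_left]
    ring
  have hL : Integrable (fun ω : (Fin D → ℝ) × ((Fin N → Fin D → ℝ) × (Fin N → ℝ)) =>
      Real.log (regGram c ω.2.1).det) μ :=
    ((integrable_log_det_regGram (N := N) (D := D) hc).comp_fst (noiseLaw N σ)).comp_snd ν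
  have hLint : ∫ ω, Real.log (regGram c ω.2.1).det ∂μ =
      ∫ X : Fin N → Fin D → ℝ, Real.log (regGram c X).det ∂(gaussianMatrixLaw N D) := by
    rw [hμ, integral_fun_snd (fun z : (Fin N → Fin D → ℝ) × (Fin N → ℝ) =>
      Real.log (regGram c z.1).det),
      integral_fun_fst (fun X : Fin N → Fin D → ℝ => Real.log (regGram c X).det)]
    simp
  have hE : Integrable (fun ω => ω.2.2 ⬝ᵥ ω.2.2) μ :=
    integrable_noise_sq (N := N) (σ := σ) (ν := ν)
  have hEint : ∫ ω, ω.2.2 ⬝ᵥ ω.2.2 ∂μ = N * σ ^ 2 := by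
    rw [hμ, integral_fun_snd (fun z : (Fin N → Fin D → ℝ) × (Fin N → ℝ) => z.2 ⬝ᵥ z.2),
      integral_fun_snd (fun e : Fin N → ℝ => e ⬝ᵥ e)]
    have := integral_dotProduct_mulVec_pi_gaussianReal (ι := Fin N) (σ ^ 2).toNNReal 1
    simp only [Matrix.one_mulVec, Matrix.trace_one, Real.coe_toNNReal _ (sq_nonneg σ)] at this
    rw [noiseLaw, this]
    simp [mul_comm]
  obtain ⟨hQ, hQint⟩ := integral_quadratic_output (N := N) (σ := σ) hc hD hν
  rw [← hμ] at hQ hQint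
  have hLE : Integrable (fun ω => (1 / 2) * Real.log (regGram c ω.2.1).det +
      (-1 / (2 * σ ^ 2)) * (ω.2.2 ⬝ᵥ ω.2.2)) μ := (hL.const_mul _).add (hE.const_mul _)
  have hI : Integrable (fun ω => Real.log (likelihoodRatio (σ ^ 2) c
      (ω.1, (Matrix.of ω.2.1 *ᵥ ω.1 + ω.2.2, ω.2.1)))) μ := by
    simp_rw [hpt]
    exact hLE.add (hQ.const_mul _)
  have : IsProbabilityMeasure (channelJointLaw N D σ
      (Measure.pi fun _ => gaussianReal 0 (P / D).toNNReal)).snd := inferInstance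
  rw [klDiv_eq_of_withDensity hcont.measurable (likelihoodRatio_pos hc)
    (channelJointLaw_eq_withDensity_likelihoodRatio hP hσ ν)]
  · congr 1
    rw [channelJointLaw, integral_map measurable_channel.aemeasurable
      hlog.aestronglyMeasurable, ← hμ]
    simp_rw [hpt]
    rw [integral_add hLE (hQ.const_mul _),
      integral_add (hL.const_mul _) (hE.const_mul _), integral_const_mul, integral_const_mul,
      integral_const_mul, hLint, hEint, hQint, (integrable_trace_regGram_inv hc).2, hcdef]
    have : (D : ℝ) ≠ 0 := by positivity
    field_simp
    ring
  · exact (integrable_map_measure hlog.aestronglyMeasurable measurable_channel.aemeasurable).2 hI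

lemma integrable_dotProduct_self_of_admissible {ν : Measure (Fin D → ℝ)} (hP : 0 ≤ P)
    (hν : ν ∈ admissibleInputs D P) :
    Integrable (fun b => b ⬝ᵥ b) ν ∧ ∫ b, b ⬝ᵥ b ∂ν ≤ P := by
  have heq : ∀ b : Fin D → ℝ, b ⬝ᵥ b = ∑ i, b i ^ 2 := fun b => by simp [dotProduct, pow_two]
  have hnn : ∀ b : Fin D → ℝ, 0 ≤ ∑ i, b i ^ 2 := fun b => Finset.sum_nonneg fun i _ => sq_nonneg _
  have hm : AEStronglyMeasurable (fun b : Fin D → ℝ => ∑ i, b i ^ 2) ν :=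
    Continuous.aestronglyMeasurable (by fun_prop)
  simp_rw [heq]
  constructor
  · refine ⟨hm, ?_⟩
    rw [hasFiniteIntegral_iff_ofReal (Filter.Eventually.of_forall hnn)]
    exact hν.2.trans_lt ENNReal.ofReal_lt_top
  · rw [integral_eq_lintegral_of_nonneg_ae (Filter.Eventually.of_forall hnn) hm]
    exact ENNReal.toReal_le_of_le_ofReal hP hν.2

/-- For an admissible input the excess term has a nonnegative coefficient times E|β|² − P ≤ 0. The
isotropic Gaussian spends exactly P, and the reference output law is its own marginal, so both
inequalities become equalities. -/
lemma channelCapacity_eq (hD : 0 < D) (hP : 0 ≤ P) (hσ : 0 < σ) :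
    channelCapacity N D P σ = ENNReal.ofReal ((1 / 2) * ∫ X : Fin N → Fin D → ℝ,
        Real.log (regGram (P / σ ^ 2 / D) X).det ∂(gaussianMatrixLaw N D)) := by
  have hD' : (D : ℝ) ≠ 0 := by positivity
  have hc : 0 ≤ P / σ ^ 2 / D := by positivity
  set g : Measure (Fin D → ℝ) := Measure.pi fun _ => gaussianReal 0 (P / D).toNNReal with hg
  have hgint : ∫ b : Fin D → ℝ, b ⬝ᵥ b ∂g = P := by
    have := integral_dotProduct_mulVec_pi_gaussianReal (ι := Fin D) (P / D).toNNReal 1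
    simp only [Matrix.one_mulVec, Matrix.trace_one, Real.coe_toNNReal (P / D) (by positivity),
      Fintype.card_fin] at this
    rw [hg, this]
    field_simp
  have hgi : Integrable (fun b : Fin D → ℝ => b ⬝ᵥ b) g :=
    integrable_dotProduct_self_pi_gaussianReal _
  refine le_antisymm (iSup₂_le fun ν hν => ?_) ?_
  · have := hν.1
    obtain ⟨hi, hle⟩ := integrable_dotProduct_self_of_admissible hP hν
    have h := mutualInfo_le_klDiv_prod (channelJointLaw N D σ ν) (channelJointLaw N D σ g).snd
    rw [fst_channelJointLaw, klDiv_channelJointLaw hD hP hσ hi] at h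
    refine h.trans (ENNReal.ofReal_le_ofReal (add_le_of_nonpos_right ?_))
    refine mul_nonpos_of_nonneg_of_nonpos (div_nonneg (integral_nonneg fun X =>
      trace_transpose_mul_inv_mul_nonneg (regGram_posDef hc X) _) (by positivity)) (by linarith)
  · have hadm : g ∈ admissibleInputs D P := by
      refine ⟨inferInstance, ?_⟩
      rw [← hgint, ofReal_integral_eq_lintegral_ofReal hgi
        (Filter.Eventually.of_forall fun b => Finset.sum_nonneg fun i _ => mul_self_nonneg _)]
      simp [dotProduct, pow_two]
    refine le_trans ?_ (le_iSup₂ (f := fun ν _ => mutualInfo (channelJointLaw N D σ ν)) g hadm)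
    rw [mutualInfo, fst_channelJointLaw, klDiv_channelJointLaw hD hP hσ hgi, hgint]
    simp

end Capacity

/-! ### Negative moments and expected logarithm of chi-squared variables. -/

section ChiSquared

variable {k : ℕ}

/-- Polar coordinates reduce the moment to a Gamma integral. The constant must only be independent
of `u`: the case `u = 0`, where the integral is 1, determines it afterwards, without the volume of
the unit ball. -/
lemma integral_dotProduct_rpow_pi_gaussianReal_aux (hk : 0 < k) :
    ∃ K : ℝ, ∀ u : ℝ, 0 ≤ u → u < k / 2 →
      ∫ x : Fin k → ℝ, (x ⬝ᵥ x) ^ (-u) ∂(Measure.pi fun _ : Fin k => gaussianReal 0 1) =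
        K * (2 ^ (-u) * Real.Gamma (k / 2 - u)) := by
  have : Nonempty (Fin k) := ⟨⟨0, hk⟩⟩
  set C : ℝ := (√(2 * Real.pi))⁻¹ ^ Fintype.card (Fin k) with hC
  have hC0 : 0 ≤ C := by positivity
  refine ⟨k * (volume.real (Metric.ball (0 : EuclideanSpace ℝ (Fin k)) 1) *
    (C * (2 ^ ((k : ℝ) / 2) * (1 / 2)))), fun u hu0 hu => ?_⟩
  have hm : Measurable fun x : Fin k → ℝ => C * Real.exp (-(x ⬝ᵥ x) / 2) := by
    unfold dotProduct; fun_prop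
  rw [pi_gaussianReal_eq_withDensity, integral_withDensity_eq_integral_toReal_smul
    hm.ennreal_ofReal (Filter.Eventually.of_forall fun _ => ENNReal.ofReal_lt_top)]
  set f : ℝ → ℝ := fun r => C * Real.exp (-r ^ 2 / 2) * (r ^ 2) ^ (-u) with hf
  have h1 : ∀ x : Fin k → ℝ, (ENNReal.ofReal (C * Real.exp (-(x ⬝ᵥ x) / 2))).toReal •
      (x ⬝ᵥ x) ^ (-u) = f ‖WithLp.toLp 2 x‖ := fun x => by
    have hx : ‖WithLp.toLp 2 x‖ ^ 2 = x ⬝ᵥ x := by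
      rw [EuclideanSpace.norm_sq_eq]; simp [dotProduct, pow_two]
    rw [ENNReal.toReal_ofReal (by positivity), smul_eq_mul]
    simp only [hf, hx]
  simp_rw [h1]
  rw [(PiLp.volume_preserving_toLp (Fin k)).integral_comp
    (MeasurableEquiv.toLp 2 _).measurableEmbedding
    (fun y : EuclideanSpace ℝ (Fin k) => f ‖y‖)]
  rw [integral_fun_norm_addHaar volume f, finrank_euclideanSpace_fin, nsmul_eq_mul, smul_eq_mul]
  have h2 : ∫ y in Set.Ioi (0 : ℝ), y ^ (k - 1) • f y =
      C * ∫ y in Set.Ioi (0 : ℝ), y ^ ((k : ℝ) - 1 - 2 * u) * Real.exp (-(1 / 2) * y ^ (2 : ℝ)) := by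
    rw [← integral_const_mul]
    refine setIntegral_congr_fun measurableSet_Ioi fun y hy => ?_
    have hy' : (0 : ℝ) < y := hy
    have e1 : (y ^ 2) ^ (-u) = y ^ (-(2 * u)) := by
      rw [← Real.rpow_natCast, ← Real.rpow_mul hy'.le]; congr 1; push_cast; ring
    have e2 : y ^ (k - 1) = y ^ ((k : ℝ) - 1) := by
      rw [← Real.rpow_natCast, Nat.cast_sub hk, Nat.cast_one]
    have e3 : y ^ ((k : ℝ) - 1 - 2 * u) = y ^ ((k : ℝ) - 1) * y ^ (-(2 * u)) := by
      rw [← Real.rpow_add hy']; rfl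
    simp only [hf, smul_eq_mul, e1, e2, e3, Real.rpow_two]
    rw [show -y ^ 2 / 2 = -(1 / 2) * y ^ 2 by ring]
    ring
  rw [h2, integral_rpow_mul_exp_neg_mul_rpow (by norm_num) (by linarith) (by norm_num)]
  have e4 : (1 / 2 : ℝ) ^ (-((k : ℝ) - 1 - 2 * u + 1) / 2) = 2 ^ ((k : ℝ) / 2) * 2 ^ (-u) := by
    rw [← Real.rpow_add (by norm_num), one_div, Real.inv_rpow (by norm_num),
      ← Real.rpow_neg (by norm_num)]
    congr 1; ring
  rw [e4, show ((k : ℝ) - 1 - 2 * u + 1) / 2 = k / 2 - u by ring]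
  ring

lemma integral_dotProduct_rpow_pi_gaussianReal (hk : 0 < k) {u : ℝ} (hu0 : 0 ≤ u)
    (hu : u < k / 2) :
    ∫ x : Fin k → ℝ, (x ⬝ᵥ x) ^ (-u) ∂(Measure.pi fun _ : Fin k => gaussianReal 0 1) =
      2 ^ (-u) * Real.Gamma (k / 2 - u) / Real.Gamma (k / 2) := by
  obtain ⟨K, hK⟩ := integral_dotProduct_rpow_pi_gaussianReal_aux hk
  have hk' : (0 : ℝ) < k / 2 := by positivity
  have h0 := hK 0 le_rfl hk'
  simp only [neg_zero, Real.rpow_zero, integral_const, probReal_univ, smul_eq_mul, one_mul,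
    sub_zero] at h0
  have hG := Real.Gamma_pos_of_pos hk'
  rw [hK u hu0 hu, eq_div_iff hG.ne']
  linear_combination -(2 ^ (-u) * Real.Gamma (k / 2 - u)) * h0

/-- A nonintegrable function has Bochner integral 0 by convention, but the value already computed is
positive. -/
lemma integrable_dotProduct_rpow_pi_gaussianReal (hk : 0 < k) {u : ℝ} (hu0 : 0 ≤ u)
    (hu : u < k / 2) : Integrable (fun x : Fin k → ℝ => (x ⬝ᵥ x) ^ (-u))
      (Measure.pi fun _ : Fin k => gaussianReal 0 1) := by
  by_contra h
  have h1 := integral_undef h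
  rw [integral_dotProduct_rpow_pi_gaussianReal hk hu0 hu] at h1
  have := Real.Gamma_pos_of_pos (show (0 : ℝ) < k / 2 by positivity)
  have := Real.Gamma_pos_of_pos (show (0 : ℝ) < k / 2 - u by linarith)
  exact absurd h1 (by positivity)

lemma integrable_log_one_add_mul_dotProduct {c : ℝ} (hc : 0 ≤ c) :
    Integrable (fun x : Fin k → ℝ => Real.log (1 + c * (x ⬝ᵥ x)))
      (Measure.pi fun _ : Fin k => gaussianReal 0 1) := by
  have hnn : ∀ x : Fin k → ℝ, 0 ≤ c * (x ⬝ᵥ x) := fun x =>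
    mul_nonneg hc (Finset.sum_nonneg fun i _ => mul_self_nonneg _)
  refine ((integrable_dotProduct_self_pi_gaussianReal (ι := Fin k) 1).const_mul c).mono' ?_
    (Filter.Eventually.of_forall fun x => ?_)
  · refine Continuous.aestronglyMeasurable (Continuous.log (by unfold dotProduct; fun_prop)
      fun x => by linarith [hnn x])
  · rw [Real.norm_eq_abs, abs_of_nonneg (Real.log_nonneg (by linarith [hnn x]))]
    have := Real.log_le_sub_one_of_pos (show 0 < 1 + c * (x ⬝ᵥ x) by linarith [hnn x])
    linarith

/-- For W = |x|² and u > 0, log W ≥ (1 − W^(-u))/u. Integrating gives (1 − M(u))/u with M(u) = E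
W^(-u), which tends to −M'(0) = log 2 + Ψ(k/2) as u → 0⁺. Only the numbers pass to the limit, so
neither dominated convergence nor integrability of log W is needed. -/
lemma log_add_realDigamma_le_integral_log (hk : 0 < k) {c : ℝ} (hc : 0 < c) :
    Real.log c + (Real.log 2 + realDigamma (k / 2)) ≤
      ∫ x : Fin k → ℝ, Real.log (1 + c * (x ⬝ᵥ x))
        ∂(Measure.pi fun _ : Fin k => gaussianReal 0 1) := by
  have : Nonempty (Fin k) := ⟨⟨0, hk⟩⟩
  have hk' : (0 : ℝ) < k / 2 := by positivity
  have hG := Real.Gamma_pos_of_pos hk'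
  set M : ℝ → ℝ := fun u => 2 ^ (-u) * Real.Gamma (k / 2 - u) / Real.Gamma (k / 2) with hM
  have hbound : ∀ u : ℝ, 0 < u → u < k / 2 → Real.log c + (1 - M u) / u ≤
      ∫ x : Fin k → ℝ, Real.log (1 + c * (x ⬝ᵥ x))
        ∂(Measure.pi fun _ : Fin k => gaussianReal 0 1) := fun u hu0 hu => by
    have hint := integrable_dotProduct_rpow_pi_gaussianReal hk hu0.le hu
    have heq : Real.log c + (1 - M u) / u = ∫ x : Fin k → ℝ,
        (Real.log c + (1 - (x ⬝ᵥ x) ^ (-u)) / u)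
        ∂(Measure.pi fun _ : Fin k => gaussianReal 0 1) := by
      have hint' : Integrable (fun x : Fin k → ℝ => (1 - (x ⬝ᵥ x) ^ (-u)) / u)
        (Measure.pi fun _ : Fin k => gaussianReal 0 1) :=
        ((integrable_const _).sub hint).div_const _
      rw [integral_add (integrable_const _) hint',
        integral_div, integral_sub (integrable_const _) hint,
        integral_dotProduct_rpow_pi_gaussianReal hk hu0.le hu]
      simp [hM]
    rw [heq]
    refine integral_mono_ae ((integrable_const _).add
      (((integrable_const _).sub hint).div_const _)) (integrable_log_one_add_mul_dotProduct hc.le) ?_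
    have := nullSingletonClass_gaussianReal (μ := 0) (v := 1) one_ne_zero
    have : NullSingletonClass (Measure.pi fun _ : Fin k => gaussianReal 0 1) :=
      Measure.pi_nullSingletonClass ⟨0, hk⟩
    have hne : ∀ᵐ x : Fin k → ℝ ∂(Measure.pi fun _ : Fin k => gaussianReal 0 1), x ≠ 0 :=
      Measure.ae_ne _ _
    filter_upwards [hne] with x hx
    have hW : 0 < x ⬝ᵥ x := lt_of_le_of_ne (Finset.sum_nonneg fun i _ => mul_self_nonneg _)
      (fun h => hx (dotProduct_self_eq_zero.1 h.symm))
    have h1 : (1 - (x ⬝ᵥ x) ^ (-u)) / u ≤ Real.log (x ⬝ᵥ x) := by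
      rw [div_le_iff₀ hu0]
      have := Real.log_le_sub_one_of_pos (Real.rpow_pos_of_pos hW (-u))
      rw [Real.log_rpow hW] at this
      linarith
    have h2 : Real.log c + Real.log (x ⬝ᵥ x) ≤ Real.log (1 + c * (x ⬝ᵥ x)) := by
      rw [← Real.log_mul hc.ne' hW.ne']
      exact Real.log_le_log (by positivity) (by linarith)
    linarith
  have hderiv : HasDerivAt M (-(Real.log 2 + realDigamma (k / 2))) 0 := by
    have hg : HasDerivAt Real.Gamma (deriv Real.Gamma (k / 2)) ((k : ℝ) / 2 - 0) := by
      rw [sub_zero]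
      exact (Real.differentiableAt_Gamma fun m => by
        have : (0 : ℝ) ≤ m := Nat.cast_nonneg m
        linarith).hasDerivAt
    have h1 : HasDerivAt (fun u : ℝ => Real.Gamma (k / 2 - u)) (-deriv Real.Gamma (k / 2)) 0 := by
      have := hg.comp (0 : ℝ) ((hasDerivAt_id (0 : ℝ)).const_sub ((k : ℝ) / 2))
      rwa [mul_neg_one] at this
    have h2 : HasDerivAt (fun u : ℝ => (2 : ℝ) ^ (-u)) (-Real.log 2) 0 := by
      have := (hasDerivAt_neg (0 : ℝ)).const_rpow (a := 2) (by norm_num)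
      simpa using this
    have h3 : HasDerivAt M _ 0 := (h2.mul h1).div_const (Real.Gamma (k / 2))
    refine h3.congr_deriv ?_
    rw [realDigamma, logDeriv_apply]
    simp only [neg_zero, Real.rpow_zero, sub_zero]
    field_simp
    ring
  have hM0 : M 0 = 1 := by simp [hM, hG.ne']
  have hlim := (hderiv.tendsto_slope.mono_left
    (nhdsWithin_mono 0 (s := Set.Ioi 0) fun x hx => (ne_of_gt hx))).neg.const_add (Real.log c)
  rw [neg_neg] at hlim
  refine le_of_tendsto hlim ?_
  filter_upwards [Ioo_mem_nhdsGT hk'] with u hu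
  refine le_trans (le_of_eq ?_) (hbound u hu.1 hu.2)
  rw [slope_def_field, hM0, sub_zero]
  ring

end ChiSquared

/-! ### Bounds for the expected log-determinant. -/

section LogDet

variable {M K N D : ℕ}

lemma measurePreserving_mulVec_pi_gaussianReal {k : ℕ} (U : Matrix (Fin k) (Fin K) ℝ)
    (hU : U * Uᵀ = 1) :
    MeasurePreserving (fun x => U *ᵥ x) (Measure.pi fun _ : Fin K => gaussianReal 0 1)
      (Measure.pi fun _ : Fin k => gaussianReal 0 1) := by
  have hm : Measurable fun x : Fin K → ℝ => U *ᵥ x :=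
    (Continuous.matrix_mulVec continuous_const continuous_id).measurable
  refine ⟨hm, ?_⟩
  have : IsFiniteMeasure ((Measure.pi fun _ : Fin K => gaussianReal 0 1).map fun x => U *ᵥ x) :=
    Measure.isFiniteMeasure_map _ _
  refine Eq.trans ?_ (pi_gaussianReal_eq_withDensity_of_pos (m := Fin k) 1 one_pos).symm
  refine eq_withDensity_of_charFun _ ((show (1 : Matrix (Fin k) (Fin k) ℝ).PosDef from
    Matrix.PosDef.one).smul (show (0 : ℝ) < (1 : NNReal) by simp))
    fun t => ?_
  rw [integral_map hm.aemeasurable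
    (Continuous.aestronglyMeasurable (by unfold dotProduct; fun_prop))]
  have h : ∀ x : Fin K → ℝ, (U *ᵥ x) ⬝ᵥ t = x ⬝ᵥ (Uᵀ *ᵥ t) := fun x => by
    rw [dotProduct_comm, Matrix.dotProduct_mulVec, ← Matrix.mulVec_transpose, dotProduct_comm]
  simp_rw [h]
  rw [integral_exp_dotProduct_pi_gaussianReal]
  have h2 : (Uᵀ *ᵥ t) ⬝ᵥ (Uᵀ *ᵥ t) = t ⬝ᵥ t := by
    rw [Matrix.mulVec_transpose, ← Matrix.dotProduct_mulVec, ← Matrix.mulVec_transpose,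
      Matrix.mulVec_mulVec, hU, Matrix.one_mulVec]
  rw [h2]
  simp

/-- Orthonormal vectors in the kernel of a wide matrix. -/
lemma exists_orthonormal_kernel (X : Fin M → Fin K → ℝ) :
    ∃ U : Matrix (Fin (K - M)) (Fin K) ℝ, U * Uᵀ = 1 ∧
      ∀ i, Matrix.of X *ᵥ U i = 0 := by
  set f : EuclideanSpace ℝ (Fin K) →ₗ[ℝ] (Fin M → ℝ) := (Matrix.mulVecLin (Matrix.of X)) ∘ₗ
    (WithLp.linearEquiv 2 ℝ (Fin K → ℝ)).toLinearMap with hf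
  obtain ⟨b, hb, hbf⟩ : ∃ b : Fin (K - M) → EuclideanSpace ℝ (Fin K),
      Orthonormal ℝ b ∧ ∀ i, f (b i) = 0 := by
    have hdim : K - M ≤ Module.finrank ℝ (LinearMap.ker f) := by
      have h1 := LinearMap.finrank_range_add_finrank_ker f
      have h2 := Submodule.finrank_le (LinearMap.range f)
      simp only [finrank_euclideanSpace_fin, Module.finrank_fin_fun] at h1 h2
      omega
    refine ⟨fun i => (stdOrthonormalBasis ℝ (LinearMap.ker f) (Fin.castLE hdim i) :
      EuclideanSpace ℝ (Fin K)), ?_, fun i =>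
      (stdOrthonormalBasis ℝ (LinearMap.ker f) (Fin.castLE hdim i)).2⟩
    exact ((stdOrthonormalBasis ℝ (LinearMap.ker f)).orthonormal.comp _
      (Fin.castLE_injective hdim)).comp_linearIsometry (LinearMap.ker f).subtypeₗᵢ
  refine ⟨Matrix.of fun i => (b i).ofLp, ?_, hbf⟩
  ext i j
  have h := orthonormal_iff_ite.1 hb i j
  rw [PiLp.inner_apply] at h
  rw [Matrix.mul_apply, Matrix.one_apply, ← h]
  refine Finset.sum_congr rfl fun l _ => ?_
  simp only [Matrix.transpose_apply, Matrix.of_apply, RCLike.inner_apply, conj_trivial]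
  exact mul_comm _ _

/-- Kernel vectors of X are fixed by I + cXᵀX, so the form dominates |Ux|² for an orthonormal family
U of K − M of them. Then Ux is a standard Gaussian in dimension K − M. -/
lemma log_add_realDigamma_le_integral_log_regGram_inv (hMK : M < K) {c : ℝ} (hc : 0 < c) (X : Fin M → Fin K → ℝ) :
    Real.log c + (Real.log 2 + realDigamma (((K : ℝ) - M) / 2)) ≤
      ∫ x : Fin K → ℝ, Real.log (1 + c * (x ⬝ᵥ ((regGram c fun k i => X i k)⁻¹ *ᵥ x)))
        ∂(Measure.pi fun _ : Fin K => gaussianReal 0 1) := by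
  obtain ⟨U, hU, hker⟩ := exists_orthonormal_kernel X
  have hA := regGram_posDef hc.le fun k i => X i k
  have hk : 0 < K - M := by omega
  have h1 := log_add_realDigamma_le_integral_log hk hc
  rw [Nat.cast_sub hMK.le] at h1
  refine h1.trans ?_
  have hp := measurePreserving_mulVec_pi_gaussianReal U hU
  have hI := integrable_log_one_add_mul_dotProduct (k := K - M) hc.le
  rw [← hp.map_eq, integral_map hp.measurable.aemeasurable (by
    rw [hp.map_eq]; exact hI.aestronglyMeasurable)]
  have hnn : ∀ x : Fin K → ℝ, 0 ≤ c * (x ⬝ᵥ ((regGram c fun k i => X i k)⁻¹ *ᵥ x)) :=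
    fun x => mul_nonneg hc.le (dotProduct_regGram_inv_nonneg hc.le _ _)
  refine integral_mono (hp.integrable_comp_of_integrable hI) ?_ fun x => ?_
  · refine (integrable_log_one_add_mul_dotProduct (k := K) hc.le).mono' ?_
      (Filter.Eventually.of_forall fun x => ?_)
    · exact (Continuous.log (continuous_const.add (continuous_const.mul (continuous_id.dotProduct
        (Continuous.matrix_mulVec continuous_const continuous_id))))
        fun x => (show 1 + c * (x ⬝ᵥ ((regGram c fun k i => X i k)⁻¹ *ᵥ x)) ≠ 0 by
          linarith [hnn x])).aestronglyMeasurable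
    · rw [Real.norm_eq_abs, abs_of_nonneg (Real.log_nonneg (by linarith [hnn x]))]
      refine Real.log_le_log (by linarith [hnn x]) ?_
      have := mul_le_mul_of_nonneg_left
        (dotProduct_regGram_inv_le hc.le (fun k i => X i k) x) hc.le
      linarith
  · have hsq := sum_sq_le_dotProduct_inv_mulVec hA (fun i => U i) (fun i j => by
      have := congrFun (congrFun hU i) j
      rwa [Matrix.mul_apply', Matrix.one_apply] at this) (fun i => by
      rw [regGram, Matrix.add_mulVec, Matrix.one_mulVec, Matrix.smul_mulVec,
        ← Matrix.mulVec_mulVec]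
      have : (Matrix.of fun k i => X i k)ᵀ *ᵥ U i = 0 := hker i
      rw [this]; simp) x
    have hUx : (U *ᵥ x) ⬝ᵥ (U *ᵥ x) = ∑ i, (U i ⬝ᵥ x) ^ 2 := by
      simp [dotProduct, Matrix.mulVec, pow_two]
    have h0 : 0 ≤ c * ∑ i, (U i ⬝ᵥ x) ^ 2 :=
      mul_nonneg hc.le (Finset.sum_nonneg fun i _ => sq_nonneg _)
    simp only [hUx]
    refine Real.log_le_log (by linarith) ?_
    have := mul_le_mul_of_nonneg_left hsq hc.le
    linarith

lemma det_regGram_transpose (c : ℝ) (X : Fin N → Fin D → ℝ) :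
    (regGram c fun k i => X i k).det = (regGram c X).det :=
  (det_one_add_smul_mul_transpose_comm c (Matrix.of X)).symm

/-- On the K × K side a new row adds the rank-one term c xxᵀ to I + cXᵀX, and the matrix determinant
lemma applies. -/
lemma det_regGram_cons {c : ℝ} (hc : 0 ≤ c) (x : Fin K → ℝ) (X : Fin M → Fin K → ℝ) :
    (regGram c (Fin.cons x X : Fin (M + 1) → Fin K → ℝ)).det =
      (regGram c X).det * (1 + c * (x ⬝ᵥ ((regGram c fun k i => X i k)⁻¹ *ᵥ x))) := by
  rw [← det_regGram_transpose c (Fin.cons x X : Fin (M + 1) → Fin K → ℝ),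
    ← det_regGram_transpose c X,
    ← det_add_smul_vecMulVec (regGram_posDef hc _)]
  congr 1
  unfold regGram
  ext a b
  simp [Matrix.mul_apply, Fin.sum_univ_succ, Matrix.vecMulVec_apply]
  ring

/-- Induction on rows: the new row is independent of the M earlier ones, so with those frozen its
factor obeys the chi-squared bound with K − M degrees of freedom. -/
lemma log_det_regGram_lower (hMK : M ≤ K) {c : ℝ} (hc : 0 < c) :
    M * Real.log c + ∑ i ∈ Finset.range M, (Real.log 2 + realDigamma (((K : ℝ) - i) / 2)) ≤
      ∫ X : Fin M → Fin K → ℝ, Real.log (regGram c X).det ∂(gaussianMatrixLaw M K) := by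
  induction M with
  | zero =>
    simp only [Nat.cast_zero, zero_mul, Finset.range_zero, Finset.sum_empty, add_zero]
    exact integral_nonneg fun X => log_det_one_add_nonneg hc.le _
  | succ M ih =>
    have ih := ih (by omega)
    set g := Measure.pi fun _ : Fin K => gaussianReal 0 1 with hg
    have hp : MeasurePreserving (fun z : (Fin K → ℝ) × (Fin M → Fin K → ℝ) =>
        (Fin.cons z.1 z.2 : Fin (M + 1) → Fin K → ℝ)) (g.prod (gaussianMatrixLaw M K))
        (gaussianMatrixLaw (M + 1) K) := by
      have h := (measurePreserving_piFinSuccAbove (fun _ : Fin (M + 1) => g) 0).symm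
      have heq : ⇑(MeasurableEquiv.piFinSuccAbove (fun _ : Fin (M + 1) => Fin K → ℝ) 0).symm =
          fun z => (Fin.cons z.1 z.2 : Fin (M + 1) → Fin K → ℝ) := by
        ext z
        simp [MeasurableEquiv.piFinSuccAbove, Fin.insertNthEquiv]
      rw [heq] at h
      exact h
    have hI := integrable_log_det_regGram (N := M + 1) (D := K) hc.le
    have hI' := hp.integrable_comp_of_integrable hI
    rw [← hp.map_eq, integral_map hp.measurable.aemeasurable
      (by rw [hp.map_eq]; exact hI.aestronglyMeasurable)]
    have hsplit : ∀ z : (Fin K → ℝ) × (Fin M → Fin K → ℝ),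
        Real.log (regGram c (Fin.cons z.1 z.2 : Fin (M + 1) → Fin K → ℝ)).det =
        Real.log (regGram c z.2).det +
          Real.log (1 + c * (z.1 ⬝ᵥ ((regGram c fun k i => z.2 i k)⁻¹ *ᵥ z.1))) := fun z => by
      have := mul_nonneg hc.le (dotProduct_regGram_inv_nonneg hc.le (fun k i => z.2 i k) z.1)
      rw [det_regGram_cons hc.le, Real.log_mul (regGram_posDef hc.le _).det_pos.ne'
        (by linarith)]
    have hI1 : Integrable (fun z : (Fin K → ℝ) × (Fin M → Fin K → ℝ) =>
        Real.log (regGram c z.2).det) (g.prod (gaussianMatrixLaw M K)) :=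
      (integrable_log_det_regGram hc.le).comp_snd g
    have hI2 : Integrable (fun z : (Fin K → ℝ) × (Fin M → Fin K → ℝ) =>
        Real.log (1 + c * (z.1 ⬝ᵥ ((regGram c fun k i => z.2 i k)⁻¹ *ᵥ z.1))))
        (g.prod (gaussianMatrixLaw M K)) := by
      refine (hI'.sub hI1).congr (Filter.Eventually.of_forall fun z => ?_)
      simp only [Pi.sub_apply, Function.comp, hsplit, add_sub_cancel_left]
    simp_rw [hsplit]
    rw [integral_add hI1 hI2, integral_fun_snd (fun X : Fin M → Fin K → ℝ =>
      Real.log (regGram c X).det), probReal_univ, one_smul, integral_prod_symm _ hI2,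
      Finset.sum_range_succ, Nat.cast_succ]
    have hstep : Real.log c + (Real.log 2 + realDigamma (((K : ℝ) - M) / 2)) ≤
        ∫ X : Fin M → Fin K → ℝ, ∫ x : Fin K → ℝ,
          Real.log (1 + c * (x ⬝ᵥ ((regGram c fun k i => X i k)⁻¹ *ᵥ x))) ∂g
          ∂(gaussianMatrixLaw M K) := by
      refine le_trans (le_of_eq ?_) (integral_mono (integrable_const _) hI2.integral_prod_right
        fun X => log_add_realDigamma_le_integral_log_regGram_inv (by omega) hc X)
      simp
    linarith

/-- The tangent point 1 + cK is the mean of trace/M (when M > 0), so the linear correction vanishes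
in expectation. -/
lemma log_det_regGram_upper {c : ℝ} (hc : 0 ≤ c) :
    ∫ X : Fin M → Fin K → ℝ, Real.log (regGram c X).det ∂(gaussianMatrixLaw M K) ≤
      M * Real.log (1 + c * K) := by
  have ht : 0 < 1 + c * K := by positivity
  have hS := integrable_sum_sq_gaussianMatrixLaw (N := M) (D := K)
  have hb : ∀ X : Fin M → Fin K → ℝ, Real.log (regGram c X).det ≤
      M * Real.log (1 + c * K) + (M + c * ∑ i, ∑ k, X i k ^ 2) / (1 + c * K) - M := fun X => by
    have := (regGram_posDef hc X).log_det_le ht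
    rwa [show (regGram c X).trace = M + c * ∑ i, ∑ k, X i k ^ 2 by
      rw [regGram, Matrix.trace_add, Matrix.trace_one, Matrix.trace_smul,
        trace_mul_transpose_eq_sum, Fintype.card_fin, smul_eq_mul], Fintype.card_fin] at this
  have hI1 : Integrable (fun X : Fin M → Fin K → ℝ => ((M : ℝ) + c * ∑ i, ∑ k, X i k ^ 2))
    (gaussianMatrixLaw M K) := (integrable_const _).add (hS.const_mul c)
  have hI2 : Integrable (fun X : Fin M → Fin K → ℝ => M * Real.log (1 + c * K) +
    (M + c * ∑ i, ∑ k, X i k ^ 2) / (1 + c * K)) (gaussianMatrixLaw M K) :=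
    (integrable_const _).add (hI1.div_const _)
  refine (integral_mono (integrable_log_det_regGram hc) (hI2.sub (integrable_const (M : ℝ))) hb).trans ?_
  rw [integral_sub' hI2 (integrable_const (M : ℝ)), integral_add (integrable_const _) (hI1.div_const _),
    integral_div, integral_add (integrable_const _) (hS.const_mul c),
    integral_const_mul c,
    integral_sum_sq_gaussianMatrixLaw]
  simp only [integral_const, probReal_univ, smul_eq_mul, one_mul]
  refine le_of_eq ?_
  field_simp
  ring

/-- Uncurried, both laws are products of one Gaussian over pairs of indices, and transposition swaps
the pair. -/
lemma measurePreserving_transpose_gaussianMatrixLaw :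
    MeasurePreserving (fun (X : Fin N → Fin D → ℝ) k i => X i k)
      (gaussianMatrixLaw N D) (gaussianMatrixLaw D N) := by
  have hm : ∀ N D : ℕ, Measurable fun (X : Fin N → Fin D → ℝ) k i => X i k := fun N D =>
    measurable_pi_lambda _ fun k => measurable_pi_lambda _ fun i =>
      (measurable_pi_apply k).comp (measurable_pi_apply i)
  refine ⟨hm N D, ?_⟩
  have hG : ∀ N D : ℕ, gaussianMatrixLaw N D = Measure.map (MeasurableEquiv.curry (Fin N) (Fin D) ℝ)
      (Measure.pi fun _ => gaussianReal 0 1) := fun N D => by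
    have := Measure.infinitePi_map_curry (fun (_ : Fin N) (_ : Fin D) => gaussianReal 0 1)
    simp only [Measure.infinitePi_eq_pi] at this
    exact this.symm
  have hp := measurePreserving_piCongrLeft (fun _ : Fin D × Fin N => gaussianReal 0 1)
    (Equiv.prodComm (Fin N) (Fin D))
  rw [hG N D, hG D N, ← hp.map_eq, Measure.map_map (hm N D) (MeasurableEquiv.measurable _),
    Measure.map_map (MeasurableEquiv.measurable _) (MeasurableEquiv.measurable _)]
  rfl

lemma integral_log_det_regGram_transpose (c : ℝ) (hc : 0 ≤ c) :
    ∫ X : Fin N → Fin D → ℝ, Real.log (regGram c X).det ∂(gaussianMatrixLaw N D) =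
      ∫ X : Fin D → Fin N → ℝ, Real.log (regGram c X).det ∂(gaussianMatrixLaw D N) := by
  have hp := measurePreserving_transpose_gaussianMatrixLaw (N := N) (D := D)
  rw [← hp.map_eq, integral_map hp.measurable.aemeasurable
    (continuous_log_det_regGram hc).aestronglyMeasurable]
  simp_rw [det_regGram_transpose]

end LogDet

/-! ### Assembly of the theorem. -/

lemma sum_Icc_realDigamma (M K : ℕ) :
    ∑ i ∈ Finset.Icc 1 M, realDigamma (((K : ℝ) - i + 1) / 2) =
      ∑ i ∈ Finset.range M, realDigamma (((K : ℝ) - i) / 2) := by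
  rw [← Finset.Ico_add_one_right_eq_Icc, Finset.sum_Ico_eq_sum_range]
  refine Finset.sum_congr (by simp) fun i _ => ?_
  congr 1
  push_cast
  ring

theorem mainTheorem6 (N D : ℕ) (hN : 0 < N) (hD : 0 < D) (P σ : ℝ) (hP : 0 < P) (hσ : 0 < σ) :
    channelCapacity N D P σ ≠ ⊤ ∧
    Integrable (logDetGram N D (signalToNoise P σ)) (gaussianMatrixLaw N D) ∧
    (channelCapacity N D P σ).toReal =
      (1 / 2) * ∫ X, logDetGram N D (signalToNoise P σ) X ∂(gaussianMatrixLaw N D) ∧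
    (D ≤ N →
      (D / 2 : ℝ) * Real.log (2 * signalToNoise P σ / D) +
          (1 / 2) * ∑ i ∈ Finset.Icc 1 D, realDigamma (((N : ℝ) - i + 1) / 2)
        ≤ (channelCapacity N D P σ).toReal ∧
      (channelCapacity N D P σ).toReal
        ≤ (D / 2 : ℝ) * Real.log ((N / D : ℝ) * signalToNoise P σ + 1)) ∧
    (N < D →
      (N / 2 : ℝ) * Real.log (2 * signalToNoise P σ / D) +
          (1 / 2) * ∑ i ∈ Finset.Icc 1 N, realDigamma (((D : ℝ) - i + 1) / 2)
        ≤ (channelCapacity N D P σ).toReal ∧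
      (channelCapacity N D P σ).toReal
        ≤ (N / 2 : ℝ) * Real.log (signalToNoise P σ + 1)) := by
  have hD' : (0 : ℝ) < D := by positivity
  have hs : 0 < signalToNoise P σ := by unfold signalToNoise; positivity
  set s := signalToNoise P σ with hsdef
  have hc : 0 < s / D := by positivity
  have hlog : logDetGram N D s = fun X => Real.log (regGram (s / D) X).det := rfl
  have hcap := channelCapacity_eq (N := N) hD hP.le hσ
  rw [show P / σ ^ 2 / D = s / D from rfl] at hcap
  have hreal : (channelCapacity N D P σ).toReal =
      (1 / 2) * ∫ X, logDetGram N D s X ∂(gaussianMatrixLaw N D) := by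
    rw [hcap, ENNReal.toReal_ofReal]
    · rfl
    · exact mul_nonneg (by norm_num) (integral_nonneg fun X => log_det_one_add_nonneg hc.le _)
  have hlog2 : Real.log (2 * s / D) = Real.log 2 + Real.log (s / D) := by
    rw [mul_div_assoc, Real.log_mul (by norm_num) hc.ne']
  refine ⟨hcap ▸ ENNReal.ofReal_ne_top, hlog ▸ integrable_log_det_regGram hc.le, hreal,
    fun hDN => ?_, fun hND => ?_⟩
  -- The row bounds need at most as many rows as columns, so they are used for the D × N transpose.
  · have hlow := log_det_regGram_lower hDN hc
    have hup := log_det_regGram_upper (M := D) (K := N) hc.le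
    rw [← integral_log_det_regGram_transpose _ hc.le, ← hlog] at hlow hup
    rw [Finset.sum_add_distrib, Finset.sum_const, Finset.card_range, nsmul_eq_mul] at hlow
    rw [show 1 + s / D * N = N / D * s + 1 by ring] at hup
    rw [sum_Icc_realDigamma, hreal, hlog2]
    constructor <;> linarith
  · have hlow := log_det_regGram_lower hND.le hc
    have hup := log_det_regGram_upper (M := N) (K := D) hc.le
    rw [← hlog] at hlow hup
    rw [Finset.sum_add_distrib, Finset.sum_const, Finset.card_range, nsmul_eq_mul] at hlow
    rw [show 1 + s / D * D = s + 1 by field_simp; ring] at hup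
    rw [sum_Icc_realDigamma, hreal, hlog2]
    constructor <;> linarith
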